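/- Let $A$ be a finite alphabet, and let $A^\diamond$ be the set of words over $A$ (labellings by letters of $A$, up to isomorphism) whose domain is a countable scattered linear ordering, the empty ordering included; an ordering is scattered if none of its suborderings with at least two elements is dense. Then a language $L\subseteq A^\diamond$ is accepted by a priority automaton if and only if it is $\diamond$-recognizable. Consequently, if $L\subseteq A^\diamond$ is accepted by a priority automaton, then so is its complement $A^\diamond\setminus L$. Here the notions are as follows. *Priority automata.* A cut of a linear ordering $\alpha$ is a pair $(E,F)$ partitioning $\alpha$ with $E<F$ ($E$ or $F$ may be empty); cuts are ordered by inclusion of $E$, with least element $\bot=(\emptyset,\alpha)$ and greatest element $\top=(\alpha,\emptyset)$. For $x\in\alpha$ let $x^-$ and $x^+$ be the cuts just before and just after $x$. A cut is a left limit if it is not $\bot$ and not of the form $x^+$, and a right limit if it is not $\top$ and not of the form $x^-$. A priority automaton consists of a finite set $Q$ of states, sets $I,F\subseteq Q$ of initial and final states, a natural number $N$, a priority mapping $p:Q\to[1,N]$ and a transition relation $\delta\subseteq(Q\times A\times Q)\uplus([1,N]\times Q)\uplus(Q\times[1,N])$. A run over a word $u:\alpha\to A$ is a mapping $\rho$ from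 the cuts of $\alpha$ to $Q$ such that $(\rho(x^-),u(x),\rho(x^+))\in\delta$ for every $x\in\alpha$; $(k,\rho(c))\in\delta$ with $k=\max\bigcap_{c'<c}p(\rho(]c',c[))$ for every left limit $c$; and $(\rho(c),k)\in\delta$ with $k=\max\bigcap_{c'>c}p(\rho(]c,c'[))$ for every right limit $c$. The word is accepted if there is a run $\rho$ with $\rho(\bot)\in I$ and $\rho(\top)\in F$. *Recognizability.* A $\diamond$-semigroup $(S,\pi)$ is a set $S$ with a map $\pi:S^\diamond\to S$ such that $\pi(s)=s$ for every one-letter word $s\in S$, and $\pi(\prod_{i\in\alpha}\pi(u_i))=\pi(\prod_{i\in\alpha}u_i)$ for every countable scattered linear ordering $\alpha$ and every family $(u_i)_{i\in\alpha}$ in $S^\diamond$, where $\prod$ denotes concatenation along $\alpha$. In particular $(A^\diamond,\prod)$ is a $\diamond$-semigroup. A morphism from $(S,\pi)$ to $(S',\pi')$ is a map $\varphi:S\to S'$ with $\varphi(\pi(\prod_{i\in\alpha}x_i))=\pi'(\prod_{i\in\alpha}\varphi(x_i))$ for all countable scattered $\alpha$ and all families $(x_i)_{i\in\alpha}$ in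 $S$. A language $K\subseteq A^\diamond$ is $\diamond$-recognizable if there is a morphism $\varphi$ of $\diamond$-semigroups from $A^\diamond$ to a finite $\diamond$-semigroup with $\varphi^{-1}(\varphi(K))=K$. -/

import Mathlib

universe u v

/-! ### Scattered linear orderings -/

/-- A linear ordering is scattered if none of its suborderings with at least two elements
is dense. -/
class IsScattered (α : Type u) [LinearOrder α] : Prop where
  not_dense : ∀ s : Set α, s.Nontrivial → ¬ DenselyOrdered s

/-- An ordering with at most one element is scattered. -/
instance (priority := low) isScattered_of_subsingleton (α : Type u) [LinearOrder α]
    [Subsingleton α] : IsScattered α :=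
  ⟨fun _ hs _ => Set.not_nontrivial_iff.2 (Set.subsingleton_of_subsingleton) hs⟩

/-- A scattered sum of scattered orderings is scattered. Here `Σₗ i, β i` is the sum of the
orderings `β i` along `ι`. -/
instance isScattered_sigmaLex {ι : Type u} [LinearOrder ι] [IsScattered ι] {β : ι → Type v}
    [∀ i, LinearOrder (β i)] [∀ i, IsScattered (β i)] : IsScattered (Σₗ i, β i) := by
  refine ⟨fun s hs hd => ?_⟩
  by_cases h : ∃ i : ι, {b : β i | (toLex ⟨i, b⟩ : Σₗ i, β i) ∈ s}.Nontrivial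
  · obtain ⟨i, hi⟩ := h
    refine IsScattered.not_dense _ hi ⟨?_⟩
    rintro ⟨a, ha⟩ ⟨b, hb⟩ hab
    obtain ⟨⟨⟨j, z⟩, hz⟩, h1, h2⟩ := hd.dense ⟨_, ha⟩ ⟨_, hb⟩
      (show (toLex ⟨i, a⟩ : Σₗ i, β i) < toLex ⟨i, b⟩ from Sigma.Lex.right _ _ hab)
    have h1' : Sigma.Lex (· < ·) (fun i => ((· < ·) : β i → β i → Prop)) ⟨i, a⟩ ⟨j, z⟩ := h1
    have h2' : Sigma.Lex (· < ·) (fun i => ((· < ·) : β i → β i → Prop)) ⟨j, z⟩ ⟨i, b⟩ := h2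
    cases h1' with
    | left _ _ h1' =>
      cases h2' with
      | left _ _ h2' => exact absurd h1' (lt_asymm h2')
      | right _ _ h2' => exact absurd h1' (lt_irrefl _)
    | right _ _ h1' =>
      cases h2' with
      | left _ _ h2' => exact absurd h2' (lt_irrefl _)
      | right _ _ h2' => exact ⟨⟨_, hz⟩, h1', h2'⟩
  · push Not at h
    have inj : ∀ (i : ι) (a b : β i), (toLex ⟨i, a⟩ : Σₗ i, β i) ∈ s →
        (toLex ⟨i, b⟩ : Σₗ i, β i) ∈ s → a = b := fun i a b ha hb => h i ha hb
    have key : ∀ x ∈ s, ∀ y ∈ s, x < y → (ofLex x).1 < (ofLex y).1 := by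
      rintro ⟨i, a⟩ hx ⟨j, b⟩ hy hxy
      have hxy' : Sigma.Lex (· < ·) (fun i => ((· < ·) : β i → β i → Prop)) ⟨i, a⟩ ⟨j, b⟩ := hxy
      rw [Sigma.lex_iff] at hxy'
      rcases hxy' with hxy' | ⟨e, hxy'⟩
      · exact hxy'
      · obtain rfl : i = j := e
        exact absurd (inj i a b hx hy ▸ hxy') (lt_irrefl _)
    refine IsScattered.not_dense ((fun x => (ofLex x).1) '' s) ?_ ⟨?_⟩
    · obtain ⟨x, hx, y, hy, hxy⟩ := hs
      refine ⟨_, ⟨x, hx, rfl⟩, _, ⟨y, hy, rfl⟩, ?_⟩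
      rcases lt_or_gt_of_ne hxy with h' | h'
      · exact (key _ hx _ hy h').ne
      · exact (key _ hy _ hx h').ne'
    · rintro ⟨_, x, hx, rfl⟩ ⟨_, y, hy, rfl⟩ hxy
      have hlt : x < y := by
        rcases lt_trichotomy x y with h' | h' | h'
        · exact h'
        · subst h'; exact absurd hxy (lt_irrefl _)
        · exact absurd (key _ hy _ hx h') (lt_asymm hxy)
      obtain ⟨⟨z, hz⟩, h1, h2⟩ := hd.dense ⟨x, hx⟩ ⟨y, hy⟩ hlt
      exact ⟨⟨_, z, hz, rfl⟩, key _ hx _ hz h1, key _ hz _ hy h2⟩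

instance countable_sigmaLex {ι : Type u} [Countable ι] {β : ι → Type v} [∀ i, Countable (β i)] :
    Countable (Σₗ i, β i) :=
  inferInstanceAs (Countable (Σ i, β i))

/-! ### Words indexed by countable scattered linear orderings -/

/-- A word over the alphabet `A` whose domain is a countable scattered linear ordering
(possibly empty). As every countable ordering is isomorphic to one in `Type`, the domains are
taken there. -/
structure ScatteredWord (A : Type u) : Type (max u 1) where
  domain : Type
  [order : LinearOrder domain]
  [countable : Countable domain]
  [scattered : IsScattered domain]
  letter : domain → A

attribute [instance] ScatteredWord.order ScatteredWord.countable ScatteredWord.scattered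

/-- Isomorphism of words. -/
def ScatteredWord.Iso {A : Type u} (w w' : ScatteredWord A) : Prop :=
  ∃ e : w.domain ≃o w'.domain, ∀ x, w'.letter (e x) = w.letter x

instance ScatteredWord.setoid (A : Type u) : Setoid (ScatteredWord A) where
  r := ScatteredWord.Iso
  iseqv :=
    { refl := fun w => ⟨OrderIso.refl _, fun _ => rfl⟩
      symm := fun {w w'} ⟨e, he⟩ => ⟨e.symm, fun x => by rw [← he, e.apply_symm_apply]⟩
      trans := fun {_ _ _} ⟨e, he⟩ ⟨f, hf⟩ => ⟨e.trans f, fun x => by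
        rw [OrderIso.trans_apply, hf, he]⟩ }

/-- `Diamond A` is `A^⋄`: the words over `A` indexed by countable scattered linear orderings,
up to isomorphism. -/
def Diamond (A : Type u) : Type (max u 1) := Quotient (ScatteredWord.setoid A)

namespace Diamond

variable {A : Type u} {α β : Type} [LinearOrder α] [Countable α] [IsScattered α]
  [LinearOrder β] [Countable β] [IsScattered β]

/-- The element of `A^⋄` given by an `α`-word. -/
def of (u : α → A) : Diamond A := Quotient.mk _ ⟨α, u⟩

/-- The word with the single letter `a`. -/
def single (a : A) : Diamond A := of (fun _ : Unit => a)

/-- The product `∏_{i ∈ α} u i` of a family of words: the concatenation of the words `u i` along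
`α`, whose domain is the sum along `α` of the domains of the `u i`. -/
noncomputable def prod (u : α → Diamond A) : Diamond A :=
  of (fun x : (Σₗ i, (u i).out.domain) => (u (ofLex x).1).out.letter (ofLex x).2)

theorem of_eq_of {u : α → A} {v : β → A} (e : α ≃o β) (h : ∀ x, v (e x) = u x) : of u = of v :=
  Quotient.sound ⟨e, h⟩

theorem of_eq_of_strictMono {u : α → A} {v : β → A} (e : α ≃ β) (he : StrictMono e)
    (h : ∀ x, v (e x) = u x) : of u = of v :=
  of_eq_of (he.orderIsoOfSurjective _ e.surjective) h

theorem of_out (w : Diamond A) : of w.out.letter = w := Quotient.out_eq w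

theorem exists_iso_of_out (u : α → A) :
    ∃ e : α ≃o (of u).out.domain, ∀ x, (of u).out.letter (e x) = u x :=
  Quotient.exact (Quotient.out_eq (of u)).symm

/-- The product may be computed from any representatives of the factors. -/
theorem prod_of {γ : α → Type} [∀ i, LinearOrder (γ i)] [∀ i, Countable (γ i)]
    [∀ i, IsScattered (γ i)] (v : ∀ i, γ i → A) :
    prod (fun i => of (v i)) = of (fun x : (Σₗ i, γ i) => v (ofLex x).1 (ofLex x).2) := by
  choose e he using fun i => exists_iso_of_out (v i)
  symm
  refine of_eq_of_strictMono
    (Equiv.sigmaCongrRight fun i => (e i).toEquiv :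
      (Σ i, γ i) ≃ (Σ i, (of (v i)).out.domain)) ?_ ?_
  · rintro ⟨i, a⟩ ⟨j, b⟩ hab
    have hab' : Sigma.Lex (· < ·) (fun i => ((· < ·) : γ i → γ i → Prop)) ⟨i, a⟩ ⟨j, b⟩ := hab
    cases hab' with
    | left _ _ h => exact Sigma.Lex.left _ _ h
    | right _ _ h => exact Sigma.Lex.right _ _ ((e i).strictMono h)
  · rintro ⟨i, a⟩
    exact he i a

/-- The product only depends on the family up to reindexing. -/
theorem prod_reindex (e : α ≃o β) (u : α → Diamond A) (v : β → Diamond A)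
    (h : ∀ x, v (e x) = u x) : prod u = prod v := by
  obtain rfl : (fun x => v (e x)) = u := funext h
  refine of_eq_of_strictMono
    (Equiv.sigmaCongrLeft (β := fun i => (v i).out.domain) e.toEquiv :
      (Σ i, (v (e i)).out.domain) ≃ (Σ i, (v i).out.domain)) ?_ ?_
  · rintro ⟨i, a⟩ ⟨j, b⟩ hab
    have hab' : Sigma.Lex (· < ·)
      (fun i => ((· < ·) : (v (e i)).out.domain → (v (e i)).out.domain → Prop))
        ⟨i, a⟩ ⟨j, b⟩ := hab
    cases hab' with
    | left _ _ h => exact Sigma.Lex.left _ _ (e.strictMono h)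
    | right _ _ h => exact Sigma.Lex.right _ _ h
  · rintro ⟨i, a⟩
    rfl

/-- The product of a word whose letters are words. -/
noncomputable def flatten (w : Diamond (Diamond A)) : Diamond A :=
  Quotient.lift (fun w : ScatteredWord (Diamond A) => prod w.letter)
    (fun w w' (h : ScatteredWord.Iso w w') => h.elim fun e he => prod_reindex e _ _ he) w

theorem flatten_of (u : α → Diamond A) : flatten (of u) = prod u := rfl

theorem flatten_single (w : Diamond A) : flatten (single w) = w := by
  refine Eq.trans ?_ (of_out w)
  refine of_eq_of_strictMono
    (Equiv.uniqueSigma (fun _ : Unit => w.out.domain) :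
      (Σ _ : Unit, w.out.domain) ≃ w.out.domain) ?_ ?_
  · rintro ⟨i, a⟩ ⟨j, b⟩ hab
    have hab' : Sigma.Lex (· < ·)
      (fun _ : Unit => ((· < ·) : w.out.domain → w.out.domain → Prop)) ⟨i, a⟩ ⟨j, b⟩ := hab
    cases hab' with
    | left _ _ h => exact absurd h (lt_irrefl _)
    | right _ _ h => exact h
  · rintro ⟨i, a⟩
    rfl

/-- Generalized associativity of the product. -/
theorem flatten_flatten (u : α → Diamond (Diamond A)) :
    flatten (of fun i => flatten (u i)) = flatten (prod u) := by
  have h1 : (fun i => flatten (u i)) = fun i =>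
      of (fun x : (Σₗ j, ((u i).out.letter j).out.domain) =>
        ((u i).out.letter (ofLex x).1).out.letter (ofLex x).2) := by
    funext i
    conv_lhs => rw [← of_out (u i)]
    rfl
  rw [h1, flatten_of, prod_of]
  symm
  refine of_eq_of_strictMono
    (Equiv.sigmaAssoc (fun i (j : (u i).out.domain) => ((u i).out.letter j).out.domain) :
      (Σ x : (Σ i, (u i).out.domain), ((u x.1).out.letter x.2).out.domain) ≃
        (Σ i, Σ j, ((u i).out.letter j).out.domain)) ?_ ?_
  · rintro ⟨⟨i, a⟩, c⟩ ⟨⟨j, b⟩, d⟩ hab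
    have hab' : Sigma.Lex (Sigma.Lex (· < ·)
        (fun i => ((· < ·) : (u i).out.domain → (u i).out.domain → Prop)))
      (fun x => ((· < ·) : ((u x.1).out.letter x.2).out.domain →
        ((u x.1).out.letter x.2).out.domain → Prop)) ⟨⟨i, a⟩, c⟩ ⟨⟨j, b⟩, d⟩ := hab
    cases hab' with
    | left _ _ h =>
      cases h with
      | left _ _ h => exact Sigma.Lex.left _ _ h
      | right _ _ h => exact Sigma.Lex.right _ _ (Sigma.Lex.left _ _ h)
    | right _ _ h => exact Sigma.Lex.right _ _ (Sigma.Lex.right _ _ h)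
  · rintro ⟨⟨i, a⟩, c⟩
    rfl

end Diamond

/-! ### ⋄-semigroups and recognizability -/

/-- A ⋄-semigroup: a set `S` with a generalized product `π : S^⋄ → S`. -/
class DiamondSemigroup (S : Type u) where
  π : Diamond S → S
  π_single : ∀ s : S, π (Diamond.single s) = s
  π_prod : ∀ (α : Type) [LinearOrder α] [Countable α] [IsScattered α] (u : α → Diamond S),
    π (Diamond.of fun i => π (u i)) = π (Diamond.prod u)

/-- The free ⋄-semigroup `(A^⋄, ∏)`. -/
noncomputable instance Diamond.diamondSemigroup (A : Type u) : DiamondSemigroup (Diamond A) where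
  π := Diamond.flatten
  π_single := Diamond.flatten_single
  π_prod := fun _ _ _ _ u => Diamond.flatten_flatten u

/-- Morphisms of ⋄-semigroups. -/
def IsDiamondMorphism {S : Type u} {T : Type v} [DiamondSemigroup S] [DiamondSemigroup T]
    (φ : S → T) : Prop :=
  ∀ (α : Type) [LinearOrder α] [Countable α] [IsScattered α] (x : α → S),
    φ (DiamondSemigroup.π (Diamond.of x)) = DiamondSemigroup.π (Diamond.of fun i => φ (x i))

/-- A language `K ⊆ A^⋄` is ⋄-recognizable if some morphism of ⋄-semigroups from `A^⋄` to a
finite ⋄-semigroup saturates it. -/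
def IsDiamondRecognizable {A : Type u} (K : Set (Diamond A)) : Prop :=
  ∃ (S : Type) (_ : Finite S) (_ : DiamondSemigroup S) (φ : Diamond A → S),
    IsDiamondMorphism φ ∧ φ ⁻¹' (φ '' K) = K

/-! ### Cuts and priority automata -/

/-- Cuts `(E, F)` of `α`, represented by their lower part `E` (and `F` is the complement of `E`).
They are ordered by inclusion, `⊥ = (∅, α)` and `⊤ = (α, ∅)`. -/
abbrev Cut (α : Type u) [LinearOrder α] : Type u := LowerSet α

namespace Cut

variable {α : Type u} [LinearOrder α]

/-- The cut `x⁻` just before `x`. -/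
def before (x : α) : Cut α := LowerSet.Iio x

/-- The cut `x⁺` just after `x`, the successor of `x⁻` through `x`. -/
def after (x : α) : Cut α := LowerSet.Iic x

/-- Left limits: cuts that are approached from the left, i.e. neither minimal nor a successor. -/
def IsLeftLimit (c : Cut α) : Prop := c ≠ ⊥ ∧ ∀ x, c ≠ after x

/-- Right limits: cuts that are approached from the right, i.e. neither maximal nor a
predecessor. -/
def IsRightLimit (c : Cut α) : Prop := c ≠ ⊤ ∧ ∀ x, c ≠ before x

end Cut

/-- A priority automaton with set of states `Q` (assumed finite where it matters) over the
alphabet `A`. Its transition relation is the disjoint union of `letterTrans ⊆ Q × A × Q`,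
`leftTrans ⊆ [1,N] × Q` and `rightTrans ⊆ Q × [1,N]`. -/
structure PriorityAutomaton (Q : Type v) (A : Type u) where
  init : Set Q
  final : Set Q
  N : ℕ
  prio : Q → Set.Icc 1 N
  letterTrans : Set (Q × A × Q)
  leftTrans : Set (Set.Icc 1 N × Q)
  rightTrans : Set (Q × Set.Icc 1 N)

namespace PriorityAutomaton

variable {Q : Type v} {A : Type u} {α β : Type*} [LinearOrder α] [LinearOrder β]

/-- `ρ` is a run of the automaton over the `α`-word `u`. -/
structure IsRun (M : PriorityAutomaton Q A) (u : α → A) (ρ : Cut α → Q) : Prop where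
  letter : ∀ x, (ρ (Cut.before x), u x, ρ (Cut.after x)) ∈ M.letterTrans
  left : ∀ c : Cut α, c.IsLeftLimit →
    ∃ k, IsGreatest (⋂ c' ∈ Set.Iio c, M.prio '' (ρ '' Set.Ioo c' c)) k ∧ (k, ρ c) ∈ M.leftTrans
  right : ∀ c : Cut α, c.IsRightLimit →
    ∃ k, IsGreatest (⋂ c' ∈ Set.Ioi c, M.prio '' (ρ '' Set.Ioo c c')) k ∧ (ρ c, k) ∈ M.rightTrans

/-- Acceptance of an `α`-word. -/
def Accepts (M : PriorityAutomaton Q A) (u : α → A) : Prop :=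
  ∃ ρ : Cut α → Q, M.IsRun u ρ ∧ ρ ⊥ ∈ M.init ∧ ρ ⊤ ∈ M.final

/-- Acceptance is invariant under isomorphism. -/
theorem Accepts.of_iso {M : PriorityAutomaton Q A} {u : α → A} {v : β → A} (e : α ≃o β)
    (h : ∀ x, v (e x) = u x) (hu : M.Accepts u) : M.Accepts v := by
  obtain ⟨ρ, hρ, hi, hf⟩ := hu
  let f : Cut β ≃o Cut α := LowerSet.map e.symm
  have hb : ∀ y, f (Cut.before y) = Cut.before (e.symm y) := fun y => by
    simp [f, Cut.before]
  have ha : ∀ y, f (Cut.after y) = Cut.after (e.symm y) := fun y => by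
    simp [f, Cut.after]
  have hlo : ∀ c' c, ρ '' Set.Ioo (f c') (f c) = (fun c => ρ (f c)) '' Set.Ioo c' c := by
    intro c' c
    rw [← f.image_Ioo, Set.image_image]
  refine ⟨fun c => ρ (f c), ⟨fun y => ?_, fun c hc => ?_, fun c hc => ?_⟩, ?_, ?_⟩
  · have := hρ.letter (e.symm y)
    rw [← h, e.apply_symm_apply] at this
    simpa only [hb, ha] using this
  · obtain ⟨k, hk, hk'⟩ := hρ.left (f c) ⟨fun h0 => hc.1 (f.injective (by rw [h0, f.map_bot])),
      fun x hx => hc.2 (e x) (f.injective (by rw [hx, ha, e.symm_apply_apply]))⟩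
    refine ⟨k, ?_, hk'⟩
    convert hk using 1
    ext p
    simp only [Set.mem_iInter, Set.mem_Iio, f.surjective.forall, hlo, f.lt_iff_lt]
  · obtain ⟨k, hk, hk'⟩ := hρ.right (f c) ⟨fun h0 => hc.1 (f.injective (by rw [h0, f.map_top])),
      fun x hx => hc.2 (e x) (f.injective (by rw [hx, hb, e.symm_apply_apply]))⟩
    refine ⟨k, ?_, hk'⟩
    convert hk using 1
    ext p
    simp only [Set.mem_iInter, Set.mem_Ioi, f.surjective.forall, hlo, f.lt_iff_lt]
  · simpa only [f.map_bot] using hi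
  · simpa only [f.map_top] using hf

/-- The language of `A^⋄` accepted by the automaton. -/
def language (M : PriorityAutomaton Q A) : Set (Diamond A) :=
  {w | Quotient.lift (fun w : ScatteredWord A => M.Accepts w.letter)
    (fun w w' (h : ScatteredWord.Iso w w') => h.elim fun e he => propext ⟨Accepts.of_iso e he,
      Accepts.of_iso e.symm fun x => by rw [← he, e.apply_symm_apply]⟩) w}

end PriorityAutomaton

/-- A language `K ⊆ A^⋄` is accepted by some priority automaton (with finitely many states). -/
def IsPriorityAccepted {A : Type u} (K : Set (Diamond A)) : Prop :=
  ∃ (Q : Type) (_ : Finite Q) (M : PriorityAutomaton Q A), M.language = K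

/-! From recognizable to accepted: a morphism to a finite ⋄-semigroup `S` labels each pair of cuts
by the value of the factor between them, which is an additive labelling by a finite monoid. By
`exists_split` the cuts carry heights, bounded in terms of `S` only, such that two cuts of equal
height with no higher cut between them are linked by a value `E` of that height. `splitAutomaton`
guesses the height of every cut and, for each height `j`, a set containing the values read since the
cuts of height `j` not yet hidden by a higher one. Priorities are injective and ordered first by
height, so the priority seen at a limit cut names a recurrent state of dominating height `h`. Its
occurrences near the limit are linked by `E h`, hence the rest of the factor has value `omega (E h)`
or `omegaStar (E h)`, and this is what the limit transitions multiply by.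

The true split yields a run (`exists_isRun_of_split`). Conversely, any run tracks the true values,
whatever heights it guessed (`consistent_of_isRun`): its local checks extend to all pairs of cuts by
an induction over scattered orderings (`Cut.rel_of_scattered`). Giving `⊥` the top height keeps the
value of the whole prefix pending until `⊤`.

From accepted to recognizable: the profile of a word records, for each run, its two end states and
its set of visited states, and also whether the word is empty. Replacing every factor of a sum by
one of the same profile preserves the profile of the sum (`IsRun.exchange`): a limit inside a factor
is handled by the new run on that factor, while at a limit of factors only the states recurring in
cofinally many factors count. So profile equality is a congruence of finite index that saturates the
language.

Complements are then immediate, since a morphism saturating a language saturates its complement. -/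

/-! ### Scattered orderings: subsets and well-founded orderings -/

instance isScattered_coe_set (α : Type u) [LinearOrder α] [IsScattered α] (T : Set α) :
    IsScattered T := by
  refine ⟨fun s hs hd => ?_⟩
  refine IsScattered.not_dense (Subtype.val '' s) (hs.image Subtype.val_injective) ⟨?_⟩
  rintro ⟨_, a, ha, rfl⟩ ⟨_, b, hb, rfl⟩ hab
  obtain ⟨⟨c, hc⟩, h1, h2⟩ := hd.dense ⟨a, ha⟩ ⟨b, hb⟩ hab
  exact ⟨⟨c, c, hc, rfl⟩, h1, h2⟩

/-- A dense set has no least element above a given one of its points. This instance and the next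
allow products indexed by finite orderings, `ℕ` and `ℕᵒᵈ`. -/
instance (priority := low) isScattered_of_wellFoundedLT (α : Type u) [LinearOrder α]
    [WellFoundedLT α] : IsScattered α := by
  refine ⟨fun s hs hd => ?_⟩
  obtain ⟨a, ha, b, hb, hab⟩ := hs.exists_lt
  obtain ⟨c, ⟨hc, hac⟩, hmin⟩ := wellFounded_lt.has_min {x | x ∈ s ∧ a < x} ⟨b, hb, hab⟩
  obtain ⟨⟨d, hd⟩, h1, h2⟩ := hd.dense ⟨a, ha⟩ ⟨c, hc⟩ hac
  exact hmin d ⟨hd, h1⟩ h2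

instance (priority := low) isScattered_of_wellFoundedGT (α : Type u) [LinearOrder α]
    [WellFoundedGT α] : IsScattered α := by
  refine ⟨fun s hs hd => ?_⟩
  obtain ⟨a, ha, b, hb, hab⟩ := hs.exists_lt
  obtain ⟨c, ⟨hc, hac⟩, hmin⟩ := wellFounded_gt.has_min {x | x ∈ s ∧ x < b} ⟨a, ha, hab⟩
  obtain ⟨⟨d, hd⟩, h1, h2⟩ := hd.dense ⟨c, hc⟩ ⟨b, hb⟩ hac
  exact hmin d ⟨hd, h2⟩ h1

/-! ### Values of factors, the underlying monoid and ω-powers -/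

namespace DiamondSemigroup

variable {S : Type u} [DiamondSemigroup S] {α : Type} [LinearOrder α] [Countable α]
  [IsScattered α]

/-- The value of the restriction of the word `u` to a set of positions. -/
def val (u : α → S) (T : Set α) : S := π (Diamond.of fun x : T => u x)

theorem val_congr (u : α → S) {T T' : Set α} (h : T = T') : val u T = val u T' := by rw [h]

/-- The fibres of a monotone map follow each other in the order of their indices, so this is
generalized associativity in a form that avoids explicit sums. -/
theorem val_fiber {ι : Type} [LinearOrder ι] [Countable ι] [IsScattered ι] (u : α → S)
    (T : Set α) (f : α → ι) (hf : MonotoneOn f T) :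
    val u T = π (Diamond.of fun i => val u {x | x ∈ T ∧ f x = i}) := by
  unfold val
  rw [π_prod ι fun i => Diamond.of fun x : {x | x ∈ T ∧ f x = i} => u x, Diamond.prod_of]
  congr 1
  symm
  refine Diamond.of_eq_of_strictMono
    (⟨fun p => ⟨p.2.1, p.2.2.1⟩, fun x => ⟨f x, x, x.2, rfl⟩, ?_, ?_⟩ :
      (Σ i, {x | x ∈ T ∧ f x = i}) ≃ T) ?_ ?_
  · rintro ⟨_, x, hx, rfl⟩
    rfl
  · rintro ⟨x, hx⟩
    rfl
  · rintro ⟨i, x, hx, hxi⟩ ⟨j, y, hy, hyj⟩ hab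
    have hab' : Sigma.Lex (· < ·) (fun i => ((· < ·) : {x | x ∈ T ∧ f x = i} → _ → Prop))
      ⟨i, x, hx, hxi⟩ ⟨j, y, hy, hyj⟩ := hab
    change x < y
    cases hab' with
    | left _ _ h =>
      by_contra hxy
      have := hf hy hx (not_lt.1 hxy)
      rw [hxi, hyj] at this
      exact this.not_gt h
    | right _ _ h => exact h
  · rintro ⟨i, x, hx, hxi⟩
    rfl

theorem val_singleton (u : α → S) (x : α) : val u {x} = u x := by
  conv_rhs => rw [← π_single (u x)]
  refine congrArg π (Diamond.of_eq_of_strictMono (Equiv.ofUnique _ _) ?_ ?_)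
  · intro a b hab
    exact (hab.ne (Subsingleton.elim _ _)).elim
  · rintro ⟨_, rfl⟩
    rfl

noncomputable instance : One S := ⟨π (Diamond.of (Empty.elim : Empty → S))⟩

noncomputable instance : Mul S := ⟨fun s t => π (Diamond.of fun b : Bool => cond b t s)⟩

theorem val_empty (u : α → S) : val u ∅ = 1 := by
  refine congrArg π (Diamond.of_eq_of_strictMono (Equiv.equivOfIsEmpty _ _) ?_ ?_)
  · rintro ⟨_, ⟨⟩⟩
  · rintro ⟨_, ⟨⟩⟩

theorem val_union (u : α → S) (T T' : Set α) (h : ∀ x ∈ T, ∀ y ∈ T', x < y) :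
    val u (T ∪ T') = val u T * val u T' := by
  classical
  rw [val_fiber u (T ∪ T') (fun x => decide (x ∈ T'))]
  · change _ = π _
    congr 2
    funext b
    cases b
    · refine val_congr u ?_
      ext x
      simp only [Set.mem_union, decide_eq_false_iff_not, Set.mem_ofPred_eq]
      exact ⟨fun hx => hx.1.resolve_right hx.2, fun hx => ⟨.inl hx, fun hx' =>
        (h x hx x hx').false⟩⟩
    · refine val_congr u ?_
      ext x
      simp only [Set.mem_union, decide_eq_true_eq, Set.mem_ofPred_eq]
      exact ⟨fun hx => hx.2, fun hx => ⟨.inr hx, hx⟩⟩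
  · intro x hx y hy hxy
    by_cases hxT : x ∈ T'
    · have hyT : y ∈ T' := hy.resolve_left fun h' => (h y h' x hxT).not_ge hxy
      simp [hxT, hyT]
    · simp [hxT]

noncomputable instance : Monoid S where
  mul_assoc a b c := by
    -- Both bracketings evaluate the same three-letter word.
    have h0 := val_singleton ![a, b, c] 0
    have h1 := val_singleton ![a, b, c] 1
    have h2 := val_singleton ![a, b, c] 2
    have e1 := val_union ![a, b, c] {0} {1} (by simp)
    have e2 := val_union ![a, b, c] {1} {2} (by simp)
    have e3 := val_union ![a, b, c] ({0} ∪ {1}) {2} (by simp)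
    have e4 := val_union ![a, b, c] {0} ({1} ∪ {2}) (by simp)
    rw [e1, h0, h1, h2] at e3
    rw [e2, h0, h1, h2, ← Set.union_assoc] at e4
    exact e3.symm.trans e4
  one_mul a := by
    have h := val_union (fun _ : Unit => a) ∅ {()} (by simp)
    rw [val_empty, val_singleton, Set.empty_union, val_singleton] at h
    exact h.symm
  mul_one a := by
    have h := val_union (fun _ : Unit => a) {()} ∅ (by simp)
    rw [val_empty, val_singleton, Set.union_empty, val_singleton] at h
    exact h.symm

/-- The `ω`-power. -/
def omega (e : S) : S := π (Diamond.of fun _ : ℕ => e)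

/-- The backwards `ω`-power. -/
def omegaStar (e : S) : S := π (Diamond.of fun _ : ℕᵒᵈ => e)

/-- The value of the word `u` between two cuts. -/
def seg (u : α → S) (a b : Cut α) : S := val u ((b : Set α) \ a)

theorem seg_self (u : α → S) (a : Cut α) : seg u a a = 1 := by
  rw [seg, sdiff_self]
  exact val_empty u

theorem seg_mul (u : α → S) {a b c : Cut α} (hab : a ≤ b) (hbc : b ≤ c) :
    seg u a b * seg u b c = seg u a c := by
  unfold seg
  rw [← val_union]
  · refine val_congr u ?_
    rw [Set.union_comm]
    exact Set.sdiff_union_sdiff_cancel hbc hab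
  · rintro x ⟨hx, -⟩ y ⟨-, hy⟩
    exact lt_of_not_ge fun h => hy (b.lower h hx)

theorem seg_before_after (u : α → S) (x : α) : seg u (Cut.before x) (Cut.after x) = u x := by
  rw [← val_singleton u x]
  refine val_congr u ?_
  ext y
  simp [Cut.before, Cut.after, le_antisymm_iff]

theorem seg_bot_top (u : α → S) : seg u ⊥ ⊤ = π (Diamond.of u) := by
  refine congrArg π (Diamond.of_eq_of_strictMono
    (⟨fun x => x.1, fun x => ⟨x, trivial, fun h => h⟩, fun _ => rfl, fun _ => rfl⟩ : _ ≃ α) ?_ ?_)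
  · exact fun _ _ h => h
  · exact fun _ => rfl

theorem seg_eq_omega (u : α → S) (e : S) (y : ℕ → Cut α) (hy : Monotone y) (c : Cut α)
    (hc : ∀ x, x ∈ c ↔ ∃ n, x ∈ y n) (he : ∀ n, seg u (y n) (y (n + 1)) = e) :
    seg u (y 0) c = omega e := by
  have hc' : ∀ x, x ∈ c → ∃ n, x ∈ y (n + 1) := fun x hx => by
    obtain ⟨n, hn⟩ := (hc x).1 hx
    exact ⟨n, hy (Nat.le_succ n) hn⟩
  unfold seg omega
  -- A letter goes to the least `n` such that it lies before `y (n + 1)`, so the fibre over `n` is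
  -- exactly the factor from `y n` to `y (n + 1)`.
  rw [val_fiber u _ fun x => sInf {n | x ∈ y (n + 1)}]
  · congr 2
    funext n
    rw [← he n]
    refine val_congr u ?_
    ext x
    constructor
    · rintro ⟨⟨hx, hx0⟩, rfl⟩
      refine ⟨Nat.sInf_mem (hc' x hx), fun hxn => ?_⟩
      rcases h : sInf {n | x ∈ y (n + 1)} with _ | m
      · rw [h] at hxn
        exact hx0 hxn
      · rw [h] at hxn
        have : sInf {n | x ∈ y (n + 1)} ≤ m := Nat.sInf_le hxn
        lia
    · rintro ⟨h1, h2⟩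
      refine ⟨⟨(hc x).2 ⟨_, h1⟩, fun h0 => h2 (hy (Nat.zero_le n) h0)⟩, ?_⟩
      refine le_antisymm (Nat.sInf_le h1) (le_csInf ⟨n, h1⟩ fun m hm => ?_)
      by_contra hlt
      exact h2 (hy (by lia : m + 1 ≤ n) hm)
  · rintro a - b ⟨hb, -⟩ hab
    exact Nat.sInf_le ((y _).lower hab (Nat.sInf_mem (hc' b hb)))

theorem seg_eq_omegaStar (u : α → S) (e : S) (y : ℕ → Cut α) (hy : Antitone y) (c : Cut α)
    (hc : ∀ x, x ∈ c ↔ ∀ n, x ∈ y n) (he : ∀ n, seg u (y (n + 1)) (y n) = e) :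
    seg u c (y 0) = omegaStar e := by
  have hc' : ∀ x, x ∉ c → ∃ n, x ∉ y (n + 1) := fun x hx => by
    rw [hc] at hx
    push Not at hx
    obtain ⟨n, hn⟩ := hx
    exact ⟨n, fun h => hn (hy (Nat.le_succ n) h)⟩
  unfold seg omegaStar
  rw [val_fiber u _ fun x => OrderDual.toDual (sInf {n | x ∉ y (n + 1)})]
  · congr 2
    funext n
    induction n using OrderDual.rec with
    | toDual n =>
    rw [← he n]
    refine val_congr u ?_
    ext x
    constructor
    · rintro ⟨⟨hx0, hx⟩, hn⟩
      obtain rfl := OrderDual.toDual.injective hn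
      refine ⟨?_, Nat.sInf_mem (hc' x hx)⟩
      by_contra hxn
      rcases h : sInf {n | x ∉ y (n + 1)} with _ | m
      · rw [h] at hxn
        exact hxn hx0
      · rw [h] at hxn
        have : sInf {n | x ∉ y (n + 1)} ≤ m := Nat.sInf_le hxn
        lia
    · rintro ⟨h1, h2⟩
      refine ⟨⟨hy (Nat.zero_le n) h1, fun h0 => h2 ((hc x).1 h0 _)⟩, ?_⟩
      refine congrArg OrderDual.toDual
        (le_antisymm (Nat.sInf_le h2) (le_csInf ⟨n, h2⟩ fun m hm => ?_))
      by_contra hlt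
      exact hm (hy (by lia : m + 1 ≤ n) h1)
  · rintro a ⟨-, ha⟩ b - hab
    refine OrderDual.toDual_le_toDual.2 (Nat.sInf_le fun h => ?_)
    exact Nat.sInf_mem (hc' a ha) ((y _).lower hab h)

end DiamondSemigroup

/-! ### Ramseyan splits of additive labellings by finite monoids -/

/-- Stability of finite monoids: `s = (a * g) ^ n * s * b ^ n` for all `n`, and two powers of `a *
g` coincide, so a positive power of `a * g` fixes `s`. In that equation the last `g * s` collapses
to `g`. -/
theorem exists_eq_mul_of_mul_eq_self {M : Type*} [Monoid M] [Finite M] {g s a b : M}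
    (h : g * s = g) (hs : s = a * g * b) : ∃ x, s = x * g := by
  have key : ∀ n : ℕ, s = (a * g) ^ n * s * b ^ n := by
    intro n
    induction n with
    | zero => simp
    | succ n ih =>
      have : s = a * g * s * b := by rw [mul_assoc a g s, h]; exact hs
      calc s = (a * g) ^ n * (a * g * s * b) * b ^ n := by rw [← this]; exact ih
        _ = (a * g) ^ (n + 1) * s * b ^ (n + 1) := by
          rw [pow_succ (a * g), pow_succ' b]; simp only [mul_assoc]
  obtain ⟨i, j, hij, he⟩ := Finite.exists_ne_map_eq_of_infinite fun n : ℕ => (a * g) ^ n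
  wlog hlt : i < j generalizing i j
  · exact this j i hij.symm he.symm (lt_of_le_of_ne (not_lt.1 hlt) hij.symm)
  obtain ⟨p, rfl⟩ := Nat.exists_eq_add_of_lt hlt
  have h1 : (a * g) ^ (p + 1) * s = s := by
    conv_lhs => rw [key i]
    rw [← mul_assoc, ← mul_assoc, ← pow_add, add_comm (p + 1) i, ← add_assoc]
    change (a * g) ^ i = (a * g) ^ (i + p + 1) at he
    rw [← he, ← key i]
  refine ⟨(a * g) ^ p * a, ?_⟩
  rw [← h1, pow_succ]
  simp only [mul_assoc]
  rw [h]

theorem exists_eq_mul_of_mul_eq_self' {M : Type*} [Monoid M] [Finite M] {g s a b : M}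
    (h : s * g = g) (hs : s = a * g * b) : ∃ x, s = g * x := by
  have : Finite Mᵐᵒᵖ := Finite.of_equiv M MulOpposite.opEquiv
  obtain ⟨x, hx⟩ := exists_eq_mul_of_mul_eq_self (M := Mᵐᵒᵖ) (g := .op g) (s := .op s)
    (a := .op b) (b := .op a) (by rw [← MulOpposite.op_mul, h])
    (by rw [← MulOpposite.op_mul, ← MulOpposite.op_mul, ← mul_assoc, ← hs])
  exact ⟨x.unop, by simpa using congrArg MulOpposite.unop hx⟩

/-- `s` fixes `g` on the right and `g'` on the left, is a left multiple of `g` and a right multiple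
of `g'`. There is at most one such element. -/
def IsLinking {M : Type*} [Monoid M] (g g' s : M) : Prop :=
  g * s = g ∧ s * g' = g' ∧ (∃ x, s = x * g) ∧ ∃ y, s = g' * y

theorem IsLinking.mul_eq_left {M : Type*} [Monoid M] {g g' s t : M} (hs : IsLinking g g' s)
    (ht : IsLinking g g' t) : s * t = s := by
  obtain ⟨-, -, ⟨x, rfl⟩, -⟩ := hs
  rw [mul_assoc, ht.1]

theorem IsLinking.mul_eq_right {M : Type*} [Monoid M] {g g' s t : M} (hs : IsLinking g g' s)
    (ht : IsLinking g g' t) : s * t = t := by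
  obtain ⟨-, -, -, y, rfl⟩ := ht
  rw [← mul_assoc, hs.2.1]

theorem IsLinking.unique {M : Type*} [Monoid M] {g g' s t : M} (hs : IsLinking g g' s)
    (ht : IsLinking g g' t) : s = t :=
  (hs.mul_eq_left ht).symm.trans (hs.mul_eq_right ht)

/-- An additive labelling of the pairs `x ≤ y` of a linear ordering by a monoid. -/
structure IsAdditive {X M : Type*} [LinearOrder X] [Monoid M] (σ : X → X → M) : Prop where
  refl : ∀ x, σ x x = 1
  mul : ∀ x y z, x ≤ y → y ≤ z → σ x y * σ y z = σ x z

theorem Ultrafilter.exists_eventually_eq {Z M : Type*} [Finite M] (F : Ultrafilter Z) (f : Z → M) :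
    ∃ v, ∀ᶠ z in (F : Filter Z), f z = v := by
  by_contra h
  rw [not_exists] at h
  have h1 : ∀ v, ∀ᶠ z in (F : Filter Z), ¬ f z = v := fun v => Ultrafilter.eventually_not.2 (h v)
  have h2 := Filter.eventually_all.2 h1
  obtain ⟨z, hz⟩ := h2.exists
  exact hz _ rfl

/-- A right-invariant family of limits of `σ z x` for `z` going down in `Z`. -/
theorem exists_lower_limit {X M : Type*} [LinearOrder X] [Monoid M] [Finite M] {σ : X → X → M}
    (hσ : IsAdditive σ) (Z : Set X) :
    ∃ g : X → M, (∀ x ∈ Z, ∀ y ∈ Z, x ≤ y → g x * σ x y = g y) ∧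
      ∀ x ∈ Z, ∀ y ∈ Z, x ≤ y → ∃ z ∈ Z, z ≤ x ∧ g y = σ z y := by
  rcases Z.eq_empty_or_nonempty with rfl | hZ
  · exact ⟨fun _ => 1, by simp, by simp⟩
  have : Nonempty Z := hZ.to_subtype
  -- One ultrafilter picks the limiting values for all `x` simultaneously, which makes them
  -- compatible with multiplication on the right.
  let F : Ultrafilter Z := Ultrafilter.of Filter.atBot
  have hF : ∀ x : Z, ∀ᶠ z in (F : Filter Z), z ≤ x := fun x =>
    Ultrafilter.of_le _ (Filter.eventually_le_atBot x)
  choose g hg using fun x : X => F.exists_eventually_eq fun z : Z => σ z x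
  refine ⟨g, fun x hx y hy hxy => ?_, fun x hx y hy hxy => ?_⟩
  · obtain ⟨z, h1, h2, h3⟩ := ((hg x).and ((hg y).and (hF ⟨x, hx⟩))).exists
    rw [← h1, ← h2]
    exact hσ.mul _ _ _ h3 hxy
  · obtain ⟨z, h2, h3⟩ := ((hg y).and (hF ⟨x, hx⟩)).exists
    exact ⟨z, z.2, h3, h2.symm⟩

theorem exists_upper_limit {X M : Type*} [LinearOrder X] [Monoid M] [Finite M] {σ : X → X → M}
    (hσ : IsAdditive σ) (Z : Set X) :
    ∃ g : X → M, (∀ x ∈ Z, ∀ y ∈ Z, x ≤ y → σ x y * g y = g x) ∧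
      ∀ x ∈ Z, ∀ y ∈ Z, x ≤ y → ∃ z ∈ Z, y ≤ z ∧ g x = σ x z := by
  rcases Z.eq_empty_or_nonempty with rfl | hZ
  · exact ⟨fun _ => 1, by simp, by simp⟩
  have : Nonempty Z := hZ.to_subtype
  let F : Ultrafilter Z := Ultrafilter.of Filter.atTop
  have hF : ∀ x : Z, ∀ᶠ z in (F : Filter Z), x ≤ z := fun x =>
    Ultrafilter.of_le _ (Filter.eventually_ge_atTop x)
  choose g hg using fun x : X => F.exists_eventually_eq fun z : Z => σ x z
  refine ⟨g, fun x hx y hy hxy => ?_, fun x hx y hy hxy => ?_⟩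
  · obtain ⟨z, h1, h2, h3⟩ := ((hg x).and ((hg y).and (hF ⟨y, hy⟩))).exists
    rw [← h1, ← h2]
    exact hσ.mul _ _ _ hxy h3
  · obtain ⟨z, h2, h3⟩ := ((hg x).and (hF ⟨y, hy⟩)).exists
    exact ⟨z, z.2, h3, h2.symm⟩

/-- `h` is a Ramseyan split of `T` for the labelling `σ`: two points of the same height not
separated by a higher point are linked by the value that `E` attaches to the height. -/
structure IsSplitOn {X M : Type*} [LinearOrder X] (σ : X → X → M) (T : Set X) (N : ℕ) (E : ℕ → M)
    (h : X → ℕ) : Prop where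
  lt : ∀ x ∈ T, h x < N
  eq : ∀ x ∈ T, ∀ y ∈ T, x < y → h x = h y → (∀ z ∈ T, x < z → z < y → h z ≤ h x) →
    σ x y = E (h x)

/-- On a set where the labelling stays in one `J`-class, finitely many colours suffice to make
it constant on every colour. -/
theorem exists_colouring (M : Type*) [Monoid M] [Finite M] :
    ∃ (K : ℕ) (E : ℕ → M),
      ∀ (X : Type) [LinearOrder X] (σ : X → X → M), IsAdditive σ → ∀ Z : Set X,
        (∀ x ∈ Z, ∀ y ∈ Z, x < y → ∀ x' ∈ Z, ∀ y' ∈ Z, x' < y' →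
          ∃ a b, σ x y = a * σ x' y' * b) →
        ∃ h : X → ℕ, (∀ x, h x < K) ∧ ∀ x ∈ Z, ∀ y ∈ Z, x < y → h x = h y → σ x y = E (h x) := by
  classical
  obtain ⟨K, ⟨i⟩⟩ := Finite.exists_equiv_fin (M × M)
  let L : M × M → M := fun p => if h : ∃ s, IsLinking p.1 p.2 s then h.choose else 1
  have hL : ∀ p s, IsLinking p.1 p.2 s → L p = s := fun p s hs => by
    have h : ∃ s, IsLinking p.1 p.2 s := ⟨s, hs⟩
    simp only [L, dif_pos h]
    exact h.choose_spec.unique hs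
  refine ⟨K, fun k => if h : k < K then L (i.symm ⟨k, h⟩) else 1, ?_⟩
  intro X _ σ hσ Z hZ
  obtain ⟨g, hg, hg1⟩ := exists_lower_limit hσ Z
  obtain ⟨g', hg', hg1'⟩ := exists_upper_limit hσ Z
  -- The colour of `x` is the pair of its limiting values from below and towards above. For equal
  -- colours `σ x y` links this pair, and a linking element is unique.
  refine ⟨fun x => i (g x, g' x), fun x => (i _).2, fun x hx y hy hxy he => ?_⟩
  have he' : (g x, g' x) = (g y, g' y) := i.injective (Fin.ext he)
  obtain ⟨e1, e2⟩ := Prod.mk.inj he'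
  dsimp only
  rw [dif_pos (i _).2]
  simp only [Fin.eta, Equiv.symm_apply_apply]
  symm
  apply hL
  have h1 : g x * σ x y = g x := by rw [hg x hx y hy hxy.le, e1]
  have h2 : σ x y * g' x = g' x := by conv_lhs => rw [e2, hg' x hx y hy hxy.le]
  -- The limits are themselves values of `σ` on `Z`, so `σ x y` is a two-sided multiple of each;
  -- stability makes it a one-sided multiple.
  obtain ⟨z, hz, hzx, hz'⟩ := hg1 x hx y hy hxy.le
  obtain ⟨t, ht, hty, ht'⟩ := hg1' x hx y hy hxy.le
  obtain ⟨a, b, hab⟩ := hZ x hx y hy hxy z hz y hy (hzx.trans_lt hxy)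
  obtain ⟨a', b', hab'⟩ := hZ x hx y hy hxy x hx t ht (hxy.trans_le hty)
  rw [← hz', ← e1] at hab
  rw [← ht'] at hab'
  exact ⟨h1, h2, exists_eq_mul_of_mul_eq_self h1 hab, exists_eq_mul_of_mul_eq_self' h2 hab'⟩

/-- Induction on the factor-closed set `U` of allowed values. An ideal `I` generated by an element
of `U`, minimal among such ideals, meets `U` in one `J`-class. Points of a maximal set `Z` with
values in `I` get the highest heights, through the colouring; the other points fall into parts whose
values avoid `I`, to which the induction applies. -/
theorem exists_splitOn (M : Type*) [Monoid M] [Finite M] (U : Set M)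
    (hU : ∀ a b, a * b ∈ U → a ∈ U ∧ b ∈ U) :
    ∃ (N : ℕ) (E : ℕ → M),
      ∀ (X : Type) [LinearOrder X] (σ : X → X → M), IsAdditive σ → ∀ T : Set X,
        (∀ x ∈ T, ∀ y ∈ T, x < y → σ x y ∈ U) → ∃ h : X → ℕ, IsSplitOn σ T N E h := by
  classical
  induction U using WellFoundedLT.induction with
  | ind U ih =>
  rcases U.eq_empty_or_nonempty with rfl | hne
  · exact ⟨1, fun _ => 1, fun X _ σ _ T hT => ⟨fun _ => 0, fun _ _ => one_pos,
      fun x hx y hy hxy => (hT x hx y hy hxy).elim⟩⟩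
  obtain ⟨m, hmU, hm⟩ := (Set.toFinite U).exists_minimalFor
    (fun m => {s : M | ∃ a b, s = a * m * b}) U hne
  set I : Set M := {s : M | ∃ a b, s = a * m * b} with hI
  have hmI : m ∈ I := ⟨1, 1, by simp⟩
  have hJ : ∀ s ∈ U, s ∈ I → ∀ t ∈ U, t ∈ I → ∃ a b, s = a * t * b := by
    rintro s hs ⟨a, b, rfl⟩ t ht ⟨c, d, htm⟩
    have h1 : {s : M | ∃ a b, s = a * t * b} ⊆ I := by
      rintro _ ⟨x, y, rfl⟩
      exact ⟨x * c, d * y, by rw [htm]; simp only [mul_assoc]⟩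
    obtain ⟨x, y, hxy⟩ := hm ht h1 hmI
    exact ⟨a * x, y * b, by rw [hxy]; simp only [mul_assoc]⟩
  obtain ⟨N', E', H⟩ := ih (U \ I) ⟨Set.sdiff_subset, fun h => (h hmU).2 hmI⟩ (by
    rintro a b ⟨hab, hab'⟩
    refine ⟨⟨(hU a b hab).1, ?_⟩, (hU a b hab).2, ?_⟩
    · rintro ⟨c, d, rfl⟩
      exact hab' ⟨c, d * b, by simp only [mul_assoc]⟩
    · rintro ⟨c, d, rfl⟩
      exact hab' ⟨a * c, d, by simp only [mul_assoc]⟩)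
  obtain ⟨K, C, HC⟩ := exists_colouring M
  refine ⟨N' + N' + K, fun k => if k < N' then E' k else if k < N' + N' then E' (k - N')
    else C (k - (N' + N')), ?_⟩
  intro X _ σ hσ T hT
  obtain ⟨Z, hZm⟩ := zorn_subset {Z : Set X | Z ⊆ T ∧ ∀ x ∈ Z, ∀ y ∈ Z, x < y → σ x y ∈ I} (by
    intro c hc hchain
    refine ⟨⋃₀ c, ⟨Set.sUnion_subset fun s hs => (hc hs).1, ?_⟩, fun s hs =>
      Set.subset_sUnion_of_mem hs⟩
    rintro x ⟨s, hs, hx⟩ y ⟨t, ht, hy⟩ hxy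
    rcases hchain.total hs ht with h | h
    · exact (hc ht).2 x (h hx) y hy hxy
    · exact (hc hs).2 x hx y (h hy) hxy)
  obtain ⟨⟨hZT, hZ⟩, hmax⟩ := hZm
  have hnear : ∀ x ∈ T, x ∉ Z →
      (∃ z ∈ Z, z < x ∧ σ z x ∉ I) ∨ (∃ z ∈ Z, x < z ∧ σ x z ∉ I) := by
    intro x hx hxZ
    by_contra! hcon
    refine hxZ (hmax (y := insert x Z) ⟨Set.insert_subset hx hZT, ?_⟩ (Set.subset_insert x Z)
      (Set.mem_insert x Z))
    rintro a (rfl | ha) b (rfl | hb) hab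
    · exact (lt_irrefl _ hab).elim
    · exact hcon.2 b hb hab
    · exact hcon.1 a ha hab
    · exact hZ a ha b hb hab
  obtain ⟨hc, hcK, hc'⟩ := HC X σ hσ Z fun x hx y hy hxy x' hx' y' hy' hxy' =>
    hJ _ (hT x (hZT hx) y (hZT hy) hxy) (hZ x hx y hy hxy)
      _ (hT x' (hZT hx') y' (hZT hy') hxy') (hZ x' hx' y' hy' hxy')
  -- `I` is an ideal, so every factor of a value outside `I` is outside `I`.
  have hfac : ∀ a b c d, a ≤ b → b < c → c ≤ d → σ a d ∉ I → σ b c ∉ I := by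
    rintro a b c d hab hbc hcd hn ⟨x, y, hxy⟩
    refine hn ⟨σ a b * x, y * σ c d, ?_⟩
    rw [← hσ.mul a b d hab (hbc.le.trans hcd), ← hσ.mul b c d hbc.le hcd, hxy]
    simp only [mul_assoc]
  -- By maximality of `Z`, a point outside `Z` sees a value outside `I` towards some point of `Z`,
  -- on its left or else on its right. Splitting each gap of `Z` by this side makes all values
  -- within a part factors of values outside `I`.
  let left : X → Prop := fun x => ∃ z ∈ Z, z < x ∧ σ z x ∉ I
  let part : X → Set X := fun x => {y | y ∈ T ∧ y ∉ Z ∧ (left y ↔ left x) ∧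
    ∀ z ∈ Z, (z < x ↔ z < y)}
  have hpart : ∀ x y, y ∈ part x → part y = part x := by
    rintro x y ⟨-, -, h1, h2⟩
    ext w
    simp only [part, Set.mem_ofPred_eq, h1]
    exact and_congr_right fun _ => and_congr_right fun _ => and_congr_right fun _ =>
      forall₂_congr fun z hz => by rw [h2 z hz]
  -- The split is chosen per set rather than per point, so that all points of a part share it.
  have hsplit : ∀ P : Set X, ∃ h, (∃ x, P = part x) → IsSplitOn σ P N' E' h := by
    intro P
    by_cases hP : ∃ x, P = part x
    swap
    · exact ⟨fun _ => 0, fun h => (hP h).elim⟩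
    obtain ⟨x, rfl⟩ := hP
    suffices ∃ h, IsSplitOn σ (part x) N' E' h from this.imp fun h hh _ => hh
    refine H X σ hσ (part x) ?_
    rintro a ⟨haT, haZ, hal, haz⟩ b ⟨hbT, hbZ, hbl, hbz⟩ hab
    refine ⟨hT a haT b hbT hab, ?_⟩
    by_cases hl : left b
    · obtain ⟨z, hz, hzb, hzI⟩ := hl
      exact hfac z a b b ((haz z hz).1 ((hbz z hz).2 hzb)).le hab le_rfl hzI
    · obtain ⟨z, hz, hza, hzI⟩ := (hnear a haT haZ).resolve_left
        (fun h => hl (hbl.2 (hal.1 h)))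
      have hbz' : b ≤ z := not_lt.1 fun h => lt_asymm hza ((haz z hz).1 ((hbz z hz).2 h))
      exact hfac a a b z le_rfl hab hbz' hzI
  choose hp hp' using hsplit
  have hself : ∀ x ∈ T, x ∉ Z → x ∈ part x := fun x hx hxZ =>
    ⟨hx, hxZ, Iff.rfl, fun _ _ => Iff.rfl⟩
  have hlt : ∀ x ∈ T, x ∉ Z → hp (part x) x < N' := fun x hx hxZ =>
    (hp' _ ⟨x, rfl⟩).lt x (hself x hx hxZ)
  -- Disjoint ranges of heights recover the side of a point, and the range of `Z` on top makes
  -- points of `Z` separate different gaps.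
  let h : X → ℕ := fun x => if x ∈ Z then N' + N' + hc x else
    if left x then hp (part x) x else N' + hp (part x) x
  have hZh : ∀ x ∈ Z, h x = N' + N' + hc x := fun x hx => if_pos hx
  have hl : ∀ x, x ∉ Z → left x → h x = hp (part x) x := fun x hx hx' => by
    simp only [h, if_neg hx, if_pos hx']
  have hr : ∀ x, x ∉ Z → ¬ left x → h x = N' + hp (part x) x := fun x hx hx' => by
    simp only [h, if_neg hx, if_neg hx']
  have hlow : ∀ x ∈ T, x ∉ Z → h x < N' + N' := fun x hx hxZ => by
    have := hlt x hx hxZ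
    by_cases hlx : left x
    · rw [hl x hxZ hlx]; lia
    · rw [hr x hxZ hlx]; lia
  refine ⟨h, fun x hx => ?_, fun x hx y hy hxy he hmid => ?_⟩
  · by_cases hxZ : x ∈ Z
    · rw [hZh x hxZ]
      have := hcK x
      lia
    · have := hlow x hx hxZ
      lia
  · by_cases hxZ : x ∈ Z
    · have hyZ : y ∈ Z := by
        by_contra hyZ
        have h1 := hlow y hy hyZ
        have h2 := hZh x hxZ
        lia
      have h1 := hZh x hxZ
      have h2 := hZh y hyZ
      rw [hc' x hxZ y hyZ hxy (by lia), h1, if_neg (by lia), if_neg (by lia)]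
      congr 1
      lia
    · have h1 := hlow x hx hxZ
      have hyZ : y ∉ Z := fun hyZ => by
        have h2 := hZh y hyZ
        lia
      have hnZ : ∀ z ∈ Z, (z < x ↔ z < y) := fun z hz => by
        refine ⟨fun h => h.trans hxy, fun hzy => ?_⟩
        by_contra hzx
        have h2 := hmid z (hZT hz) (lt_of_le_of_ne (not_lt.1 hzx) fun h => hxZ (h ▸ hz)) hzy
        have h3 := hZh z hz
        lia
      have h3 := hlt x hx hxZ
      have h4 := hlt y hy hyZ
      have hll : left y ↔ left x := by
        by_cases hlx : left x <;> by_cases hly : left y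
        · simp [hlx, hly]
        · have h5 := hl x hxZ hlx
          have h6 := hr y hyZ hly
          lia
        · have h5 := hr x hxZ hlx
          have h6 := hl y hyZ hly
          lia
        · simp [hlx, hly]
      have hyx : y ∈ part x := ⟨hy, hyZ, hll, hnZ⟩
      have hmid' : ∀ z ∈ part x, h z = hp (part x) z + (if left x then 0 else N') := by
        intro z hz
        have := hpart x z hz
        by_cases hlx : left x
        · rw [hl z hz.2.1 (hz.2.2.1.2 hlx), this, if_pos hlx, add_zero]
        · rw [hr z hz.2.1 (fun h => hlx (hz.2.2.1.1 h)), this, if_neg hlx, add_comm]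
      have hxx := hself x hx hxZ
      rw [(hp' (part x) ⟨x, rfl⟩).eq x hxx y hyx hxy
        (by have h5 := hmid' x hxx; have h6 := hmid' y hyx; lia)
        (fun z hz hxz hzy => by
          have h5 := hmid' x hxx
          have h6 := hmid' z hz
          have h7 := hmid z hz.1 hxz hzy
          lia)]
      by_cases hlx : left x
      · rw [hl x hxZ hlx, if_pos h3]
      · rw [hr x hxZ hlx, if_neg (by lia), if_pos (by lia)]
        congr 1
        lia

/-- Every additive labelling by a finite monoid has a Ramseyan split whose number of heights only
depends on the monoid, and in which the value of a class only depends on its height. -/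
theorem exists_split (M : Type*) [Monoid M] [Finite M] :
    ∃ (N : ℕ) (E : ℕ → M),
      ∀ (X : Type) [LinearOrder X] (σ : X → X → M), IsAdditive σ →
        ∃ h : X → ℕ, IsSplitOn σ Set.univ N E h := by
  obtain ⟨N, E, H⟩ := exists_splitOn M Set.univ fun _ _ _ => ⟨trivial, trivial⟩
  exact ⟨N, E, fun X _ σ hσ => H X σ hσ _ fun _ _ _ _ _ => trivial⟩

/-! ### Cuts and induction over scattered orderings -/

namespace Cut

variable {α : Type u} [LinearOrder α]

theorem mem_of_lt {a b : Cut α} (h : a < b) : ∃ x, a ≤ before x ∧ after x ≤ b := by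
  obtain ⟨x, hxb, hxa⟩ := Set.not_subset.1 (show ¬ (b : Set α) ⊆ a from h.not_ge)
  exact ⟨x, fun y hy => lt_of_not_ge fun hxy => hxa (a.lower hxy hy), fun y hy => b.lower hy hxb⟩

theorem before_lt_after (x : α) : before x < after x :=
  lt_of_le_of_ne (fun _ hy => le_of_lt hy) fun h =>
    lt_irrefl x (show x ∈ before x from h ▸ le_refl x)

theorem le_before_of_lt_after {x : α} {c : Cut α} (h : c < after x) : c ≤ before x := fun _ hy =>
  lt_of_le_of_ne (h.le hy) fun hyx => h.not_ge fun _ hz => c.lower hz (hyx ▸ hy)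

theorem after_le_of_before_lt {x : α} {c : Cut α} (h : before x < c) : after x ≤ c := by
  by_contra h'
  exact h.not_ge (le_before_of_lt_after (not_le.1 h'))

theorem after_le_iff {x : α} {c : Cut α} : after x ≤ c ↔ x ∈ c :=
  ⟨fun h => h (le_refl x), fun h _ hy => c.lower hy h⟩

theorem le_before_iff {x : α} {c : Cut α} : c ≤ before x ↔ x ∉ c :=
  ⟨fun h hx => lt_irrefl x (h hx), fun h _ hy => lt_of_not_ge fun hxy => h (c.lower hxy hy)⟩

theorem IsLeftLimit.exists_between {c c' : Cut α} (hc : c.IsLeftLimit) (h : c' < c) :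
    ∃ d, c' < d ∧ d < c := by
  obtain ⟨x, h1, h2⟩ := mem_of_lt h
  exact ⟨after x, h1.trans_lt (before_lt_after x), lt_of_le_of_ne h2 (hc.2 x).symm⟩

theorem IsRightLimit.exists_between {c c' : Cut α} (hc : c.IsRightLimit) (h : c < c') :
    ∃ d, c < d ∧ d < c' := by
  obtain ⟨x, h1, h2⟩ := mem_of_lt h
  exact ⟨before x, lt_of_le_of_ne h1 (hc.2 x), (before_lt_after x).trans_le h2⟩

/-- An interval-closed transitive relation on the cuts of a scattered ordering that holds across
letters and is preserved by limits holds everywhere. -/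
theorem rel_of_scattered [IsScattered α] (R : Cut α → Cut α → Prop) (refl : ∀ a, R a a)
    (trans : ∀ a b c, a ≤ b → b ≤ c → R a b → R b c → R a c)
    (mono : ∀ a b c d, a ≤ b → b ≤ c → c ≤ d → R a d → R b c)
    (letter : ∀ x, R (before x) (after x))
    (left : ∀ a c, a < c → c.IsLeftLimit → (∀ b, a ≤ b → b < c → R a b) → R a c)
    (right : ∀ a c, a < c → a.IsRightLimit → (∀ b, a < b → b ≤ c → R b c) → R a c)
    {a b : Cut α} (hab : a ≤ b) : R a b := by
  -- The supremum of the cuts related to `a` is attained: it is `a`, a successor and then a member,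
  -- or a left limit covered by `left`.
  have hhi : ∀ a, ∃ s, a ≤ s ∧ R a s ∧ ∀ d, a ≤ d → R a d → d ≤ s := by
    intro a
    let D : Set (Cut α) := {d | a ≤ d ∧ R a d}
    have haD : a ∈ D := ⟨le_rfl, refl a⟩
    have has : a ≤ sSup D := le_sSup haD
    have hlt : ∀ b, b < sSup D → ∃ d ∈ D, b < d := fun b hb => by
      by_contra! h
      exact hb.not_ge (sSup_le h)
    refine ⟨sSup D, has, ?_, fun d h1 h2 => le_sSup ⟨h1, h2⟩⟩
    by_contra hR
    refine hR (left a _ (lt_of_le_of_ne has fun h => hR (h ▸ refl a)) ⟨fun h => ?_, fun x hx => ?_⟩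
      fun b hb hbs => ?_)
    · exact hR ((le_antisymm has (h ▸ bot_le)) ▸ refl a)
    · obtain ⟨d, hd, hd'⟩ := hlt (before x) (hx ▸ before_lt_after x)
      have := le_antisymm (le_sSup hd) (hx ▸ after_le_of_before_lt hd')
      exact hR (this ▸ hd.2)
    · obtain ⟨d, hd, hd'⟩ := hlt b hbs
      exact mono a a b d le_rfl hb hd'.le hd.2
  have hlo : ∀ b, ∃ s, s ≤ b ∧ R s b ∧ ∀ d, d ≤ b → R d b → s ≤ d := by
    intro b
    let D : Set (Cut α) := {d | d ≤ b ∧ R d b}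
    have hbD : b ∈ D := ⟨le_rfl, refl b⟩
    have hbs : sInf D ≤ b := sInf_le hbD
    have hlt : ∀ a, sInf D < a → ∃ d ∈ D, d < a := fun a ha => by
      by_contra! h
      exact ha.not_ge (le_sInf h)
    refine ⟨sInf D, hbs, ?_, fun d h1 h2 => sInf_le ⟨h1, h2⟩⟩
    by_contra hR
    refine hR (right _ b (lt_of_le_of_ne hbs fun h => hR (h.symm ▸ refl b))
      ⟨fun h => ?_, fun x hx => ?_⟩ fun a ha hab => ?_)
    · exact hR ((le_antisymm hbs (h ▸ le_top)).symm ▸ refl b)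
    · obtain ⟨d, hd, hd'⟩ := hlt (after x) (hx ▸ before_lt_after x)
      have := le_antisymm (hx ▸ le_before_of_lt_after hd' : d ≤ sInf D) (sInf_le hd)
      exact hR (this ▸ hd.2)
    · obtain ⟨d, hd, hd'⟩ := hlt a ha
      exact mono d a b b hd'.le hab le_rfl hd.2
  -- The furthest cut `s` reached from `a` precedes the earliest cut `t` reaching `b`. A letter
  -- between them works, since reaching its left cut would mean reaching its right cut too.
  have hmid : ∀ a b, a ≤ b → ¬ R a b → ∃ z, a ≤ before z ∧ before z ≤ b ∧ ¬ R a (before z) ∧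
      ¬ R (before z) b := by
    intro a b hab hR
    obtain ⟨s, has, hRs, hs⟩ := hhi a
    obtain ⟨t, htb, hRt, ht⟩ := hlo b
    have hst : s < t := by
      by_contra hts
      rw [not_lt] at hts
      rcases le_total s b with hsb | hbs
      · exact hR (trans a s b has hsb hRs (mono t s b b hts hsb le_rfl hRt))
      · exact hR (mono a a b s le_rfl hab hbs hRs)
    obtain ⟨z, hz, hz'⟩ := mem_of_lt hst
    have haz := has.trans hz
    have hzb := (before_lt_after z).le.trans (hz'.trans htb)
    refine ⟨z, haz, hzb, fun h => ?_, fun h => ?_⟩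
    · have := hs _ (haz.trans (before_lt_after z).le)
        (trans _ _ _ haz (before_lt_after z).le h (letter z))
      exact (before_lt_after z).not_ge (this.trans hz)
    · exact (before_lt_after z).not_ge (hz'.trans (ht _ hzb h))
  by_contra hR
  have hmono : ∀ x y : α, x ≤ y → before x ≤ before y := fun x y h _ hz => lt_of_lt_of_le hz h
  -- Letters are identified when the cuts before them are related. Two inequivalent letters have, by
  -- `hmid`, a third class between them, so one representative per class forms a dense set.
  let st : Setoid α :=
    { r := fun x y => (before x ≤ before y → R (before x) (before y)) ∧
        (before y ≤ before x → R (before y) (before x))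
      iseqv :=
        { refl := fun x => ⟨fun _ => refl _, fun _ => refl _⟩
          symm := fun h => ⟨h.2, h.1⟩
          trans := by
            have key : ∀ x y z : Cut α, (x ≤ y → R x y) → (y ≤ x → R y x) → (y ≤ z → R y z) →
                (z ≤ y → R z y) → x ≤ z → R x z := by
              intro x y z h1 h2 h3 h4 hxz
              rcases le_total x y with hxy | hyx
              · rcases le_total y z with hyz | hzy
                · exact trans x y z hxy hyz (h1 hxy) (h3 hyz)
                · exact mono x x z y le_rfl hxz hzy (h1 hxy)
              · exact mono y x z z hyx hxz le_rfl (h3 (hyx.trans hxz))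
            intro x y z h h'
            exact ⟨key _ _ _ h.1 h.2 h'.1 h'.2, key _ _ _ h'.2 h'.1 h.2 h.1⟩ } }
  let r : α → α := fun x => (Quotient.mk st x).out
  have hr : ∀ x, st.r (r x) x := fun x => Quotient.mk_out x
  have hr' : ∀ x y, st.r x y → r x = r y := fun x y h => by
    have : Quotient.mk st x = Quotient.mk st y := Quotient.sound h
    simp only [r, this]
  refine IsScattered.not_dense (Set.range r) ?_ ⟨?_⟩
  · obtain ⟨z, -, hzb, -, hn⟩ := hmid a b hab hR
    obtain ⟨w, hw, hwb, hn1, hn2⟩ := hmid _ _ hzb hn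
    refine ⟨r z, ⟨z, rfl⟩, r w, ⟨w, rfl⟩, fun he => hn1 ?_⟩
    exact (st.iseqv.trans (st.iseqv.symm (hr z)) (he ▸ hr w)).1 hw
  · rintro ⟨_, x, rfl⟩ ⟨_, y, rfl⟩ hxy
    have hxy' : r x < r y := hxy
    have hn : ¬ R (before (r x)) (before (r y)) := fun h => by
      have h1 : st.r (r x) (r y) := ⟨fun _ => h, fun h' =>
        (before_lt_after (r x)).not_ge ((after_le_iff.2 (show r x ∈ before (r y) from hxy')).trans h')
          |>.elim⟩
      have := hr' x y (st.iseqv.trans (st.iseqv.symm (hr x)) (st.iseqv.trans h1 (hr y)))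
      exact hxy'.ne this
    obtain ⟨z, h1, h2, h3, h4⟩ := hmid _ _ (hmono _ _ hxy'.le) hn
    refine ⟨⟨r z, z, rfl⟩, ?_, ?_⟩
    · change r x < r z
      by_contra hle
      have hle' := hmono _ _ (not_lt.1 hle)
      exact h3 (mono _ _ _ _ hle' h1 le_rfl ((hr z).1 (hle'.trans h1)))
    · change r z < r y
      by_contra hle
      have hle' := hmono _ _ (not_lt.1 hle)
      exact h4 (mono _ _ _ _ le_rfl h2 hle' ((hr z).2 (h2.trans hle')))

end Cut

/-! ### Recurrent states and priorities at limit cuts -/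

/-- The points of a finite colouring close to `c` on the left have colours cofinal at `c`. -/
theorem exists_forall_cofinal_left {X Q : Type*} [LinearOrder X] [Finite Q] (ρ : X → Q) {b c : X}
    (hb : b < c) : ∃ c₀ < c, ∀ d ∈ Set.Ioo c₀ c, ∀ c' < c, ∃ d' ∈ Set.Ioo c' c, ρ d' = ρ d := by
  have h : ∀ q, ∃ c₀ < c, ∀ d ∈ Set.Ioo c₀ c, ρ d = q → ∀ c' < c, ∃ d' ∈ Set.Ioo c' c, ρ d' = q := by
    intro q
    by_cases hq : ∀ c' < c, ∃ d' ∈ Set.Ioo c' c, ρ d' = q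
    · exact ⟨b, hb, fun _ _ _ => hq⟩
    · push Not at hq
      obtain ⟨c₀, h0, h1⟩ := hq
      exact ⟨c₀, h0, fun d hd hdq => (h1 d hd hdq).elim⟩
  choose f hf hf' using h
  have : Nonempty Q := ⟨ρ b⟩
  -- Beyond the largest of the finitely many thresholds, every colour that is not cofinal has died
  -- out.
  obtain ⟨q, hq⟩ := Finite.exists_max f
  exact ⟨f q, hf q, fun d hd => hf' _ d ⟨(hq _).trans_lt hd.1, hd.2⟩ rfl⟩

theorem exists_forall_cofinal_right {X Q : Type*} [LinearOrder X] [Finite Q] (ρ : X → Q) {b c : X}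
    (hb : c < b) : ∃ c₀, c < c₀ ∧
      ∀ d ∈ Set.Ioo c c₀, ∀ c', c < c' → ∃ d' ∈ Set.Ioo c c', ρ d' = ρ d := by
  obtain ⟨c₀, h0, h⟩ := exists_forall_cofinal_left (X := Xᵒᵈ) ρ (b := b) (c := c) hb
  refine ⟨c₀, h0, fun d hd c' hc' => ?_⟩
  obtain ⟨d', hd', h'⟩ := h d ⟨hd.2, hd.1⟩ c' hc'
  exact ⟨d', ⟨hd'.2, hd'.1⟩, h'⟩

namespace PriorityAutomaton

variable {Q : Type v} {A : Type u} {X : Type*} [LinearOrder X]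

theorem mem_limit_left {M : PriorityAutomaton Q A} {ρ : X → Q} {c : X} {k : Set.Icc 1 M.N} :
    (k ∈ ⋂ c' ∈ Set.Iio c, M.prio '' (ρ '' Set.Ioo c' c)) ↔
      ∀ c' < c, ∃ d ∈ Set.Ioo c' c, M.prio (ρ d) = k := by
  simp

theorem mem_limit_right {M : PriorityAutomaton Q A} {ρ : X → Q} {c : X} {k : Set.Icc 1 M.N} :
    (k ∈ ⋂ c' ∈ Set.Ioi c, M.prio '' (ρ '' Set.Ioo c c')) ↔
      ∀ c', c < c' → ∃ d ∈ Set.Ioo c c', M.prio (ρ d) = k := by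
  simp

theorem exists_isGreatest_left [Finite Q] (M : PriorityAutomaton Q A) (ρ : X → Q) {b c : X}
    (hb : b < c) (hc : ∀ c' < c, (Set.Ioo c' c).Nonempty) :
    ∃ k, IsGreatest (⋂ c' ∈ Set.Iio c, M.prio '' (ρ '' Set.Ioo c' c)) k := by
  obtain ⟨c₀, h0, h⟩ := exists_forall_cofinal_left ρ hb
  obtain ⟨d, hd⟩ := hc c₀ h0
  obtain ⟨k, hk, hk'⟩ := Set.exists_max_image
    (⋂ c' ∈ Set.Iio c, M.prio '' (ρ '' Set.Ioo c' c)) id (Set.toFinite _)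
    ⟨M.prio (ρ d), mem_limit_left.2 fun c' hc' =>
      (h d hd c' hc').imp fun d' h' => ⟨h'.1, by rw [h'.2]⟩⟩
  exact ⟨k, hk, hk'⟩

theorem exists_isGreatest_right [Finite Q] (M : PriorityAutomaton Q A) (ρ : X → Q) {b c : X}
    (hb : c < b) (hc : ∀ c', c < c' → (Set.Ioo c c').Nonempty) :
    ∃ k, IsGreatest (⋂ c' ∈ Set.Ioi c, M.prio '' (ρ '' Set.Ioo c c')) k := by
  obtain ⟨c₀, h0, h⟩ := exists_forall_cofinal_right ρ hb
  obtain ⟨d, hd⟩ := hc c₀ h0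
  obtain ⟨k, hk, hk'⟩ := Set.exists_max_image
    (⋂ c' ∈ Set.Ioi c, M.prio '' (ρ '' Set.Ioo c c')) id (Set.toFinite _)
    ⟨M.prio (ρ d), mem_limit_right.2 fun c' hc' =>
      (h d hd c' hc').imp fun d' h' => ⟨h'.1, by rw [h'.2]⟩⟩
  exact ⟨k, hk, hk'⟩

/-- Injective priorities turn the limit priority into one recurrent state. It dominates near `c`,
because past some `c₀` only recurrent states occur. -/
theorem exists_state_of_isGreatest_left [Finite Q] {M : PriorityAutomaton Q A}
    (hM : Function.Injective M.prio) {ρ : X → Q} {b c : X} (hb : b < c) {k : Set.Icc 1 M.N}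
    (hk : IsGreatest (⋂ c' ∈ Set.Iio c, M.prio '' (ρ '' Set.Ioo c' c)) k) :
    ∃ q, k = M.prio q ∧ (∀ c' < c, ∃ d ∈ Set.Ioo c' c, ρ d = q) ∧
      ∃ c₀ < c, ∀ d ∈ Set.Ioo c₀ c, M.prio (ρ d) ≤ M.prio q := by
  have h1 := mem_limit_left.1 hk.1
  obtain ⟨d, -, hd⟩ := h1 b hb
  obtain ⟨c₀, h0, h⟩ := exists_forall_cofinal_left ρ hb
  refine ⟨ρ d, hd.symm, fun c' hc' => ?_, c₀, h0, fun e he => ?_⟩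
  · obtain ⟨d', hd', he⟩ := h1 c' hc'
    exact ⟨d', hd', hM (he.trans hd.symm)⟩
  · rw [hd]
    exact hk.2 (mem_limit_left.2 fun c' hc' =>
      (h e he c' hc').imp fun d' h' => ⟨h'.1, by rw [h'.2]⟩)

theorem exists_state_of_isGreatest_right [Finite Q] {M : PriorityAutomaton Q A}
    (hM : Function.Injective M.prio) {ρ : X → Q} {b c : X} (hb : c < b) {k : Set.Icc 1 M.N}
    (hk : IsGreatest (⋂ c' ∈ Set.Ioi c, M.prio '' (ρ '' Set.Ioo c c')) k) :
    ∃ q, k = M.prio q ∧ (∀ c', c < c' → ∃ d ∈ Set.Ioo c c', ρ d = q) ∧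
      ∃ c₀, c < c₀ ∧ ∀ d ∈ Set.Ioo c c₀, M.prio (ρ d) ≤ M.prio q := by
  have h1 := mem_limit_right.1 hk.1
  obtain ⟨d, -, hd⟩ := h1 b hb
  obtain ⟨c₀, h0, h⟩ := exists_forall_cofinal_right ρ hb
  refine ⟨ρ d, hd.symm, fun c' hc' => ?_, c₀, h0, fun e he => ?_⟩
  · obtain ⟨d', hd', he⟩ := h1 c' hc'
    exact ⟨d', hd', hM (he.trans hd.symm)⟩
  · rw [hd]
    exact hk.2 (mem_limit_right.2 fun c' hc' =>
      (h e he c' hc').imp fun d' h' => ⟨h'.1, by rw [h'.2]⟩)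

end PriorityAutomaton

/-! ### ω-powers from cofinal families of cuts -/

namespace DiamondSemigroup

variable {S : Type u} [DiamondSemigroup S] {α : Type} [LinearOrder α] [Countable α]
  [IsScattered α]

/-- A value is an `ω`-power as soon as cofinally many cuts are linked by its base. -/
theorem seg_of_cofinal_left (u : α → S) (e : S) {c₀ c : Cut α} (G : Set (Cut α))
    (hG : ∀ c' < c, ∃ d ∈ Set.Ioo c' c, d ∈ G)
    (he : ∀ x ∈ G, ∀ y ∈ G, c₀ < x → x < y → y < c → seg u x y = e) {y : Cut α} (hy : y ∈ G)
    (h0 : c₀ < y) (hyc : y < c) : seg u y c = omega e := by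
  obtain ⟨x₀, -, -⟩ := Cut.mem_of_lt hyc
  have : Nonempty α := ⟨x₀⟩
  obtain ⟨f, hf⟩ := exists_surjective_nat α
  -- Countability of `α` enters here: the `n`-th step passes the `n`-th letter of an enumeration, so
  -- the resulting sequence of cuts exhausts `c`.
  have step : ∀ (n : ℕ) (z : {z // z ∈ G ∧ z < c}), ∃ z' : {z // z ∈ G ∧ z < c},
      z.1 < z'.1 ∧ (f n ∈ c → f n ∈ z'.1) := by
    rintro n ⟨z, hz, hzc⟩
    obtain ⟨z', hz', hG'⟩ := hG z hzc
    by_cases hfn : f n ∈ c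
    · obtain ⟨d, hd, hdG⟩ := hG (max z' (Cut.before (f n))) (max_lt hz'.2
        ((Cut.before_lt_after _).trans_le (Cut.after_le_iff.2 hfn)))
      exact ⟨⟨d, hdG, hd.2⟩, hz'.1.trans ((le_max_left _ _).trans_lt hd.1), fun _ =>
        Cut.after_le_iff.1 (Cut.after_le_of_before_lt ((le_max_right _ _).trans_lt hd.1))⟩
    · exact ⟨⟨z', hG', hz'.2⟩, hz'.1, fun h => (hfn h).elim⟩
  choose nxt hn1 hn2 using step
  let s : ℕ → {z // z ∈ G ∧ z < c} := fun n => Nat.rec ⟨y, hy, hyc⟩ nxt n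
  have hs : StrictMono fun n => (s n).1 := strictMono_nat_of_lt_succ fun n => hn1 n (s n)
  refine seg_eq_omega u e (fun n => (s n).1) hs.monotone c (fun x => ⟨fun hx => ?_, ?_⟩) fun n => ?_
  · obtain ⟨n, rfl⟩ := hf x
    exact ⟨n + 1, hn2 n (s n) hx⟩
  · rintro ⟨n, hn⟩
    exact (s n).2.2.le hn
  · exact he _ (s n).2.1 _ (s (n + 1)).2.1 (h0.trans_le (hs.monotone (Nat.zero_le n)))
      (hs (Nat.lt_succ_self n)) (s (n + 1)).2.2

theorem seg_of_cofinal_right (u : α → S) (e : S) {c₀ c : Cut α} (G : Set (Cut α))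
    (hG : ∀ c', c < c' → ∃ d ∈ Set.Ioo c c', d ∈ G)
    (he : ∀ x ∈ G, ∀ y ∈ G, c < x → x < y → y < c₀ → seg u x y = e) {y : Cut α} (hy : y ∈ G)
    (h0 : y < c₀) (hyc : c < y) : seg u c y = omegaStar e := by
  obtain ⟨x₀, -, -⟩ := Cut.mem_of_lt hyc
  have : Nonempty α := ⟨x₀⟩
  obtain ⟨f, hf⟩ := exists_surjective_nat α
  have step : ∀ (n : ℕ) (z : {z // z ∈ G ∧ c < z}), ∃ z' : {z // z ∈ G ∧ c < z},
      z'.1 < z.1 ∧ (f n ∉ c → f n ∉ z'.1) := by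
    rintro n ⟨z, hz, hzc⟩
    obtain ⟨z', hz', hG'⟩ := hG z hzc
    by_cases hfn : f n ∉ c
    · obtain ⟨d, hd, hdG⟩ := hG (min z' (Cut.after (f n))) (lt_min hz'.1
        ((Cut.le_before_iff.2 hfn).trans_lt (Cut.before_lt_after _)))
      exact ⟨⟨d, hdG, hd.1⟩, (hd.2.trans_le (min_le_left _ _)).trans hz'.2, fun _ =>
        Cut.le_before_iff.1 (Cut.le_before_of_lt_after (hd.2.trans_le (min_le_right _ _)))⟩
    · exact ⟨⟨z', hG', hz'.1⟩, hz'.2, fun h => (hfn h).elim⟩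
  choose nxt hn1 hn2 using step
  let s : ℕ → {z // z ∈ G ∧ c < z} := fun n => Nat.rec ⟨y, hy, hyc⟩ nxt n
  have hs : StrictAnti fun n => (s n).1 := strictAnti_nat_of_succ_lt fun n => hn1 n (s n)
  refine seg_eq_omegaStar u e (fun n => (s n).1) hs.antitone c
    (fun x => ⟨fun hx n => (s n).2.2.le hx, fun hx => ?_⟩) fun n => ?_
  · by_contra hxc
    obtain ⟨n, rfl⟩ := hf x
    exact hn2 n (s n) hxc (hx (n + 1))
  · exact he _ (s (n + 1)).2.1 _ (s n).2.1 (s (n + 1)).2.2 (hs (Nat.lt_succ_self n))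
      ((hs.antitone (Nat.zero_le n)).trans_lt h0)

end DiamondSemigroup

/-! ### The automaton that guesses and verifies a split -/

namespace DiamondSemigroup

/-- A state guesses the height of a cut in a Ramseyan split and, for every height `j`, a set
containing the values of the factors from the pending cuts of height `j`. -/
def SplitState (S : Type) (N : ℕ) (E : Fin (N + 1) → S) : Type :=
  {q : Fin (N + 1) × (Fin (N + 1) → Set S) // ∀ s ∈ q.2 q.1, s = E q.1}

namespace SplitState

variable {S : Type} {N : ℕ} {E : Fin (N + 1) → S}

instance [Finite S] : Finite (SplitState S N E) :=
  inferInstanceAs (Finite (Subtype _))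

def height (q : SplitState S N E) : Fin (N + 1) := q.1.1

def pre (q : SplitState S N E) (j : Fin (N + 1)) : Set S := q.1.2 j

/-- The values after the cut itself has been taken into account. -/
def post [One S] (q : SplitState S N E) (j : Fin (N + 1)) : Set S :=
  -- A cut hides the pending cuts of smaller height and becomes pending itself, with value `1`.
  {s | q.height ≤ j ∧ (s ∈ q.pre j ∨ s = 1 ∧ j = q.height)}

theorem eq_of_mem_pre (q : SplitState S N E) {s : S} (hs : s ∈ q.pre q.height) :
    s = E q.height := q.2 s hs

/-- An injective priority for which the height is the leading component. -/
theorem exists_prio [Finite S] (E : Fin (N + 1) → S) : ∃ (P : ℕ)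
    (p : SplitState S N E → Set.Icc 1 P), Function.Injective p ∧
      ∀ q q', p q ≤ p q' → q.height ≤ q'.height := by
  obtain ⟨K, ⟨i⟩⟩ := Finite.exists_equiv_fin (Fin (N + 1) → Set S)
  -- Lexicographic encoding with the height as leading digit, shifted by one because priorities
  -- start at `1`.
  let f : SplitState S N E → ℕ := fun q => q.1.1 * K + i q.1.2 + 1
  have hlt : ∀ q q', q.height < q'.height → f q < f q' := by
    intro q q' h
    have h1 : (q.1.1 : ℕ) + 1 ≤ q'.1.1 := h
    have h2 := Nat.mul_le_mul_right K h1
    have h3 := (i q.1.2).2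
    rw [add_mul] at h2
    simp only [f]
    lia
  have hN : ∀ q, f q ≤ (N + 1) * K := by
    intro q
    have h1 : (q.1.1 : ℕ) + 1 ≤ N + 1 := q.1.1.2
    have h2 := Nat.mul_le_mul_right K h1
    have h3 := (i q.1.2).2
    rw [add_mul] at h2
    simp only [f]
    lia
  refine ⟨(N + 1) * K, fun q => ⟨f q, Nat.succ_pos _, hN q⟩, fun q q' h => ?_, fun q q' h => ?_⟩
  · have h : f q = f q' := congrArg Subtype.val h
    have h1 : q.1.1 = q'.1.1 := by
      rcases lt_trichotomy q.1.1 q'.1.1 with h' | h' | h'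
      · exact ((hlt q q' h').ne h).elim
      · exact h'
      · exact ((hlt q' q h').ne h.symm).elim
    have h2 : q.1.2 = q'.1.2 := by
      simp only [f, h1] at h
      exact i.injective (Fin.ext (by lia))
    exact Subtype.ext (Prod.ext h1 h2)
  · by_contra h'
    exact (hlt q' q (not_le.1 h')).not_ge h

end SplitState

variable {S : Type} [DiamondSemigroup S] {N : ℕ} {E : Fin (N + 1) → S} {A : Type u}

/-- The automaton guessing a Ramseyan split and verifying it. -/
def splitAutomaton {P : ℕ} (p : SplitState S N E → Set.Icc 1 P) (φ : A → S) (F : Set S) :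
    PriorityAutomaton (SplitState S N E) A where
  -- No cut exceeds the top height, so the value read since `⊥` is never dropped and the final
  -- condition can test it.
  init := {q | q.height = Fin.last N}
  final := {q | q.post (Fin.last N) ⊆ F}
  N := P
  prio := p
  letterTrans := {t | ∀ j, ∀ s ∈ t.1.post j, s * φ t.2.1 ∈ t.2.2.pre j}
  leftTrans := {t | ∃ q, p q = t.1 ∧ ∀ j, q.height ≤ j → ∀ s ∈ q.post j,
    s * omega (E q.height) ∈ t.2.pre j}
  rightTrans := {t | ∃ q, p q = t.2 ∧ ∀ j, q.height ≤ j → ∀ s ∈ t.1.post j,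
    s * omegaStar (E q.height) ∈ q.pre j}

variable {α : Type} [LinearOrder α] [Countable α] [IsScattered α]

/-- The values guessed at `y` are compatible with those guessed at `x`. -/
def Consistent (u : α → S) (ρ : Cut α → SplitState S N E) (x y : Cut α) : Prop :=
  ∀ j, (∀ z ∈ Set.Ioo x y, (ρ z).height ≤ j) → ∀ s ∈ (ρ x).post j, s * seg u x y ∈ (ρ y).pre j

/-- The value `1` pending at `x` arrives at `y` as the value of the factor, at the height of `y`
itself; there a state only tolerates `E`. -/
theorem Consistent.seg_eq {u : α → S} {ρ : Cut α → SplitState S N E} {x y : Cut α}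
    (h : Consistent u ρ x y) (hxy : (ρ x).height = (ρ y).height)
    (hz : ∀ z ∈ Set.Ioo x y, (ρ z).height ≤ (ρ x).height) : seg u x y = E (ρ x).height := by
  have := h _ hz 1 ⟨le_rfl, .inr ⟨rfl, rfl⟩⟩
  rw [hxy] at this ⊢
  rw [one_mul] at this
  exact (ρ y).eq_of_mem_pre this

theorem Consistent.trans {u : α → S} {ρ : Cut α → SplitState S N E} {x y z : Cut α}
    (h : Consistent u ρ x y) (h' : Consistent u ρ y z) (hxy : x < y) (hyz : y < z) :
    Consistent u ρ x z := by
  intro j hj s hs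
  have h1 := h j (fun w hw => hj w ⟨hw.1, hw.2.trans hyz⟩) s hs
  have h2 := h' j (fun w hw => hj w ⟨hxy.trans hw.1, hw.2⟩) _ ⟨hj y ⟨hxy, hyz⟩, .inl h1⟩
  rwa [mul_assoc, seg_mul u hxy.le hyz.le] at h2

/-- Soundness: no assumption is made that the guessed heights form a split. Consistency on smaller
intervals already forces the occurrences of the recurrent state near a limit to be linked by `E`,
which justifies the ω-power in the limit transition. -/
theorem consistent_of_isRun [Finite S] {P : ℕ} {p : SplitState S N E → Set.Icc 1 P}
    (hp : Function.Injective p) (hp' : ∀ q q', p q ≤ p q' → q.height ≤ q'.height) {φ : A → S}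
    {F : Set S} {u : α → A} {ρ : Cut α → SplitState S N E}
    (hρ : (splitAutomaton p φ F).IsRun u ρ) {a b : Cut α} (hab : a < b) :
    Consistent (fun x => φ (u x)) ρ a b := by
  -- Quantifying over all pairs inside the interval makes the relation interval-closed.
  refine Cut.rel_of_scattered (fun a b => ∀ x y, a ≤ x → x < y → y ≤ b →
    Consistent (fun x => φ (u x)) ρ x y) ?_ ?_ ?_ ?_ ?_ ?_ hab.le a b le_rfl hab le_rfl
  · intro a x y h1 h2 h3
    exact (h2.not_ge (h3.trans h1)).elim
  · intro a b c _ _ h h' x y hax hxy hyc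
    rcases le_or_gt y b with hyb | hby
    · exact h x y hax hxy hyb
    rcases le_or_gt b x with hbx | hxb
    · exact h' x y hbx hxy hyc
    exact (h x b hax hxb le_rfl).trans (h' b y le_rfl hby hyc) hxb hby
  · intro a b c d hab _ hcd h x y hbx hxy hyc
    exact h x y (hab.trans hbx) hxy (hyc.trans hcd)
  · intro t x y hx hxy hy
    obtain rfl : x = Cut.before t := le_antisymm (Cut.le_before_of_lt_after (hxy.trans_le hy)) hx
    obtain rfl : y = Cut.after t := le_antisymm hy (Cut.after_le_of_before_lt hxy)
    intro j _ s hs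
    rw [seg_before_after]
    exact hρ.letter t j s hs
  · intro a c hac hc h x y hax hxy hyc
    rcases lt_or_eq_of_le hyc with hyc | rfl
    · exact h y (hax.trans hxy.le) hyc x y hax hxy le_rfl
    intro j hj s hs
    obtain ⟨k, hk, q, hqk, hq⟩ := hρ.left y hc
    obtain ⟨q', hkq', hq1, c₀, hc₀, hq2⟩ := PriorityAutomaton.exists_state_of_isGreatest_left
      (M := splitAutomaton p φ F) hp hac hk
    obtain rfl : q = q' := hp (hqk.trans hkq')
    -- An occurrence of the recurrent state after `x` and in the zone where `q` dominates splits the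
    -- factor: consistency reaches `d`, and the ω-power covers the rest.
    obtain ⟨d, hd, hdq⟩ := hq1 (max x c₀) (max_lt hxy hc₀)
    have hxd := (le_max_left _ _).trans_lt hd.1
    have hdj : (ρ d).height ≤ j := hj d ⟨hxd, hd.2⟩
    have h1 : seg (fun x => φ (u x)) d y = omega (E q.height) := by
      refine seg_of_cofinal_left (c₀ := max x c₀) _ _ {d | ρ d = q} hq1 ?_ hdq hd.1 hd.2
      intro v hv w hw hv0 hvw hwy
      have hx0 := (hax.trans (le_max_left x c₀)).trans hv0.le
      have := (h w (hx0.trans hvw.le) hwy v w hx0 hvw le_rfl).seg_eq (by rw [hv, hw])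
        fun z hz => ?_
      · rwa [hv] at this
      · rw [hv]
        exact hp' _ _ (hq2 z ⟨((le_max_right _ _).trans_lt hv0).trans hz.1, hz.2.trans hwy⟩)
    have h2 := h d (hax.trans hxd.le) hd.2 x d hax hxd le_rfl j
      (fun z hz => hj z ⟨hz.1, hz.2.trans hd.2⟩) s hs
    rw [hdq] at hdj h2
    have h3 := hq j hdj _ ⟨hdj, .inl h2⟩
    rwa [mul_assoc, ← h1, seg_mul _ hxd.le hd.2.le] at h3
  · intro a c hac ha h x y hax hxy hyc
    rcases lt_or_eq_of_le hax with hax | rfl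
    · exact h x hax (hxy.le.trans hyc) x y le_rfl hxy hyc
    intro j hj s hs
    obtain ⟨k, hk, q, hqk, hq⟩ := hρ.right a ha
    obtain ⟨q', hkq', hq1, c₀, hc₀, hq2⟩ := PriorityAutomaton.exists_state_of_isGreatest_right
      (M := splitAutomaton p φ F) hp hac hk
    obtain rfl : q = q' := hp (hqk.trans hkq')
    obtain ⟨d, hd, hdq⟩ := hq1 (min y c₀) (lt_min hxy hc₀)
    have hdy := hd.2.trans_le (min_le_left _ _)
    have hdj : (ρ d).height ≤ j := hj d ⟨hd.1, hdy⟩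
    have h1 : seg (fun x => φ (u x)) a d = omegaStar (E q.height) := by
      refine seg_of_cofinal_right (c₀ := min y c₀) _ _ {d | ρ d = q} hq1 ?_ hdq hd.2 hd.1
      intro v hv w hw hav hvw hwy
      have hwc := (hwy.le.trans (min_le_left y c₀)).trans hyc
      have := (h v hav (hvw.le.trans hwc) v w le_rfl hvw hwc).seg_eq (by rw [hv, hw])
        fun z hz => ?_
      · rwa [hv] at this
      · rw [hv]
        exact hp' _ _ (hq2 z ⟨hav.trans hz.1, (hz.2.trans hwy).trans_le (min_le_right _ _)⟩)
    rw [hdq] at hdj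
    have h3 := hq j hdj s hs
    rw [← h1, ← hdq] at h3
    rw [← hdq] at hdj
    have h2 := h d hd.1 (hdy.le.trans hyc) d y le_rfl hdy hyc j
      (fun z hz => hj z ⟨hd.1.trans hz.1, hz.2⟩) _ ⟨hdj, .inl h3⟩
    rwa [mul_assoc, seg_mul _ hd.1.le hdy.le] at h2

/-- The values from the pending cuts of height `j` before the cut `c`. -/
def pendingValues (u : α → S) (h : Cut α → Fin (N + 1)) (c : Cut α) (j : Fin (N + 1)) : Set S :=
  {s | ∃ x < c, h x = j ∧ (∀ z ∈ Set.Ioo x c, h z ≤ j) ∧ s = seg u x c}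

/-- Completeness: the exact pending values satisfy the constraint on states by the split property.
At a limit, occurrences of the dominating state have equal height with nothing higher between them,
so the split links them by `E`. -/
theorem exists_isRun_of_split [Finite S] {P : ℕ} {p : SplitState S N E → Set.Icc 1 P}
    (hp : Function.Injective p) (hp' : ∀ q q', p q ≤ p q' → q.height ≤ q'.height) (φ : A → S)
    (F : Set S) (u : α → A) (h : Cut α → Fin (N + 1))
    (hh : ∀ x y, x < y → h x = h y → (∀ z ∈ Set.Ioo x y, h z ≤ h x) →
      seg (fun x => φ (u x)) x y = E (h x)) :
    ∃ ρ, (splitAutomaton p φ F).IsRun u ρ ∧ (∀ c, (ρ c).height = h c) ∧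
      ∀ c, (ρ c).pre = pendingValues (fun x => φ (u x)) h c := by
  let w : α → S := fun x => φ (u x)
  let ρ : Cut α → SplitState S N E := fun c => ⟨(h c, pendingValues w h c), by
    rintro _ ⟨x, hx, hxc, hz, rfl⟩
    have hxc : h x = h c := hxc
    have hz : ∀ z ∈ Set.Ioo x c, h z ≤ h c := hz
    change seg w x c = E (h c)
    rw [← hxc] at hz ⊢
    exact hh x c hx hxc hz⟩
  have hpost : ∀ c j s, s ∈ (ρ c).post j → h c ≤ j ∧
      ∃ x ≤ c, h x = j ∧ (∀ z ∈ Set.Ioc x c, h z ≤ j) ∧ s = seg w x c := by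
    rintro c j s ⟨h1, ⟨x, hx, hxj, hz, rfl⟩ | ⟨rfl, h2⟩⟩
    · refine ⟨h1, x, hx.le, hxj, fun z hz' => ?_, rfl⟩
      rcases lt_or_eq_of_le hz'.2 with h' | rfl
      · exact hz z ⟨hz'.1, h'⟩
      · exact h1
    · exact ⟨h1, c, le_rfl, h2.symm, fun z hz => (hz.1.not_ge hz.2).elim,
        (seg_self w c).symm⟩
  refine ⟨ρ, ⟨fun t => ?_, fun c hc => ?_, fun c hc => ?_⟩, fun _ => rfl, fun _ => rfl⟩
  · intro j s hs
    obtain ⟨h1, x, hx, hxj, hz, rfl⟩ := hpost _ _ _ hs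
    refine ⟨x, hx.trans_lt (Cut.before_lt_after t), hxj, fun z hz' => hz z ⟨hz'.1,
      Cut.le_before_of_lt_after hz'.2⟩, ?_⟩
    rw [← seg_mul w hx (Cut.before_lt_after t).le, seg_before_after]
  · have hb : ⊥ < c := bot_lt_iff_ne_bot.2 hc.1
    obtain ⟨k, hk⟩ := (splitAutomaton p φ F).exists_isGreatest_left ρ hb
      fun c' hc' => hc.exists_between hc'
    refine ⟨k, hk, ?_⟩
    obtain ⟨q, rfl, hq1, c₀, hc₀, hq2⟩ := PriorityAutomaton.exists_state_of_isGreatest_left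
      (M := splitAutomaton p φ F) hp hb hk
    refine ⟨q, rfl, fun j hj s hs => ?_⟩
    obtain ⟨d, hd, hdq⟩ := hq1 c₀ hc₀
    have hbd : ∀ z ∈ Set.Ioo c₀ c, h z ≤ q.height := fun z hz => hp' (ρ z) _ (hq2 z hz)
    have h1 : seg w d c = omega (E q.height) := by
      refine seg_of_cofinal_left (c₀ := c₀) _ _ {d | ρ d = q} hq1 ?_ hdq hd.1 hd.2
      intro x hx y hy hx0 hxy hyc
      have e1 : h x = q.height := congrArg SplitState.height hx
      have e2 : h y = q.height := congrArg SplitState.height hy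
      rw [← e1] at hbd ⊢
      exact hh x y hxy (e1.trans e2.symm) fun z hz => hbd z ⟨hx0.trans hz.1, hz.2.trans hyc⟩
    rw [← hdq] at hs
    obtain ⟨-, x, hx, hxj, hz, rfl⟩ := hpost _ _ _ hs
    refine ⟨x, hx.trans_lt hd.2, hxj, fun z hz' => ?_, ?_⟩
    · rcases le_or_gt z d with hzd | hdz
      · exact hz z ⟨hz'.1, hzd⟩
      · exact (hbd z ⟨hd.1.trans hdz, hz'.2⟩).trans hj
    · rw [← h1, seg_mul w hx hd.2.le]
  · have hb : c < ⊤ := lt_top_iff_ne_top.2 hc.1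
    obtain ⟨k, hk⟩ := (splitAutomaton p φ F).exists_isGreatest_right ρ hb
      fun c' hc' => hc.exists_between hc'
    refine ⟨k, hk, ?_⟩
    obtain ⟨q, rfl, hq1, c₀, hc₀, hq2⟩ := PriorityAutomaton.exists_state_of_isGreatest_right
      (M := splitAutomaton p φ F) hp hb hk
    refine ⟨q, rfl, fun j hj s hs => ?_⟩
    obtain ⟨d, hd, hdq⟩ := hq1 c₀ hc₀
    have hbd : ∀ z ∈ Set.Ioo c c₀, h z ≤ q.height := fun z hz => hp' (ρ z) _ (hq2 z hz)
    have h1 : seg w c d = omegaStar (E q.height) := by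
      refine seg_of_cofinal_right (c₀ := c₀) _ _ {d | ρ d = q} hq1 ?_ hdq hd.2 hd.1
      intro x hx y hy hcx hxy hyc
      have e1 : h x = q.height := congrArg SplitState.height hx
      have e2 : h y = q.height := congrArg SplitState.height hy
      rw [← e1] at hbd ⊢
      exact hh x y hxy (e1.trans e2.symm) fun z hz => hbd z ⟨hcx.trans hz.1, hz.2.trans hyc⟩
    obtain ⟨-, x, hx, hxj, hz, rfl⟩ := hpost _ _ _ hs
    rw [← h1, seg_mul w hx hd.1.le]
    rw [← hdq]
    refine ⟨x, hx.trans_lt hd.1, hxj, fun z hz' => ?_, rfl⟩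
    rcases le_or_gt z c with hzc | hcz
    · exact hz z ⟨hz'.1, hzc⟩
    · exact (hbd z ⟨hcz, hz'.2.trans hd.2⟩).trans hj

/-- Some split automaton accepts exactly the words whose value lies in `F`. -/
theorem exists_automaton_of_value [Finite S] (φ : A → S) (F : Set S) :
    ∃ (Q : Type) (_ : Finite Q) (M : PriorityAutomaton Q A),
      ∀ (α : Type) [LinearOrder α] [Countable α] [IsScattered α] (u : α → A),
        M.Accepts u ↔ π (Diamond.of fun x => φ (u x)) ∈ F := by
  obtain ⟨N, E, hsplit⟩ := exists_split S
  obtain ⟨P, p, hp, hp'⟩ := SplitState.exists_prio (N := N) fun j => E j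
  refine ⟨_, inferInstance, splitAutomaton p φ F, fun α _ _ _ u => ?_⟩
  rw [← seg_bot_top]
  constructor
  · rintro ⟨ρ, hρ, hi, hf⟩
    have hi : (ρ ⊥).height = Fin.last N := hi
    have h1 : (1 : S) ∈ (ρ ⊥).post (Fin.last N) := ⟨Fin.le_last _, .inr ⟨rfl, hi.symm⟩⟩
    refine hf ?_
    rcases eq_or_ne (⊥ : Cut α) ⊤ with he | he
    · rw [← he, seg_self]
      exact h1
    · have := consistent_of_isRun hp hp' hρ (bot_lt_iff_ne_bot.2 he.symm) _
        (fun _ _ => Fin.le_last _) 1 h1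
      rw [one_mul] at this
      exact ⟨Fin.le_last _, .inl this⟩
  · intro hF
    classical
    obtain ⟨h, hh⟩ := hsplit (Cut α) (seg fun x => φ (u x))
      ⟨seg_self _, fun _ _ _ => seg_mul _⟩
    -- The split uses heights below `N`; the extra height `N` is reserved for `⊥`, so at `⊤` the
    -- only value pending at that height is the value of the word.
    let h' : Cut α → Fin (N + 1) := fun c => if c = ⊥ then Fin.last N else
      ⟨h c, (hh.lt c trivial).trans (Nat.lt_succ_self N)⟩
    have hb : h' ⊥ = Fin.last N := if_pos rfl
    have hb' : ∀ c, c ≠ ⊥ → (h' c : ℕ) = h c := fun c hc => by simp only [h', if_neg hc]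
    have hlast : ∀ c, h' c = Fin.last N → c = ⊥ := fun c hc => by
      by_contra hc'
      have h1 := hb' c hc'
      rw [hc, Fin.val_last] at h1
      exact (hh.lt c trivial).ne h1.symm
    obtain ⟨ρ, hρ, hρh, hρp⟩ := exists_isRun_of_split hp hp' φ F u h' (by
      intro x y hxy he hz
      have hy : y ≠ ⊥ := (bot_le.trans_lt hxy).ne'
      have hx : x ≠ ⊥ := fun hx => hy (hlast y (he ▸ hx ▸ hb))
      rw [hb' x hx]
      refine hh.eq x trivial y trivial hxy ?_ fun z _ hxz hzy => ?_
      · rw [← hb' x hx, ← hb' y hy, he]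
      · rw [← hb' x hx, ← hb' z (bot_le.trans_lt hxz).ne']
        exact hz z ⟨hxz, hzy⟩)
    refine ⟨ρ, hρ, (hρh ⊥).trans hb, ?_⟩
    rintro s ⟨-, hs | ⟨rfl, hs⟩⟩
    · rw [hρp] at hs
      obtain ⟨x, -, hx, -, rfl⟩ := hs
      rwa [hlast x hx]
    · rw [hρh] at hs
      have := hlast _ hs.symm
      rwa [this, seg_self] at hF

end DiamondSemigroup

/-! ### Recognizable languages are accepted -/

/-- A morphism from `A^⋄` is determined by the images of the letters. -/
theorem IsDiamondMorphism.apply_of {S : Type v} [DiamondSemigroup S] {A : Type u}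
    {φ : Diamond A → S} (hφ : IsDiamondMorphism φ) {α : Type} [LinearOrder α] [Countable α]
    [IsScattered α] (u : α → A) :
    φ (Diamond.of u) = DiamondSemigroup.π (Diamond.of fun x => φ (Diamond.single (u x))) := by
  rw [← hφ α fun x => Diamond.single (u x)]
  refine congrArg φ ?_
  change _ = Diamond.prod _
  refine Eq.trans ?_ (Diamond.prod_of fun x (_ : Unit) => u x).symm
  refine Diamond.of_eq_of_strictMono
    (⟨fun x => ⟨x, ()⟩, fun p => p.1, fun _ => rfl, fun _ => rfl⟩ : α ≃ Σ _ : α, Unit) ?_ ?_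
  · exact fun a b hab => Sigma.Lex.left _ _ hab
  · exact fun _ => rfl

theorem IsDiamondRecognizable.isPriorityAccepted {A : Type u} {L : Set (Diamond A)}
    (hL : IsDiamondRecognizable L) : IsPriorityAccepted L := by
  obtain ⟨S, _, _, φ, hφ, hφL⟩ := hL
  obtain ⟨Q, hQ, M, hM⟩ := DiamondSemigroup.exists_automaton_of_value
    (fun a => φ (Diamond.single a)) (φ '' L)
  refine ⟨Q, hQ, M, ?_⟩
  ext w
  induction w using Quotient.inductionOn with
  | h w =>
  refine (hM w.domain w.letter).trans ?_
  rw [← hφ.apply_of, ← Set.mem_preimage, hφL]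
  rfl

/-! ### Locality of limit conditions and profiles of words -/

namespace Cut

variable {α : Type*} [LinearOrder α] {β : Type*} [LinearOrder β]

/-- Stated with the trivial predicate so that the same cofinality lemmas transport both limit cuts
and limit priorities. -/
theorem isLeftLimit_iff {c : Cut α} :
    c.IsLeftLimit ↔ c ≠ ⊥ ∧ ∀ c' < c, ∃ d ∈ Set.Ioo c' c, True := by
  refine ⟨fun hc => ⟨hc.1, fun c' h => (hc.exists_between h).imp fun d hd => ⟨hd, trivial⟩⟩,
    fun hc => ⟨hc.1, ?_⟩⟩
  rintro x rfl
  obtain ⟨d, hd, -⟩ := hc.2 _ (before_lt_after x)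
  exact hd.1.not_ge (le_before_of_lt_after hd.2)

theorem isRightLimit_iff {c : Cut α} :
    c.IsRightLimit ↔ c ≠ ⊤ ∧ ∀ c', c < c' → ∃ d ∈ Set.Ioo c c', True := by
  refine ⟨fun hc => ⟨hc.1, fun c' h => (hc.exists_between h).imp fun d hd => ⟨hd, trivial⟩⟩,
    fun hc => ⟨hc.1, ?_⟩⟩
  rintro x rfl
  obtain ⟨d, hd, -⟩ := hc.2 _ (before_lt_after x)
  exact hd.2.not_ge (after_le_of_before_lt hd.1)

/-- Cofinality on the left is local, hence the same in an interval of cuts. -/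
theorem cofinal_left_comp (f : Cut β ↪o Cut α)
    (hf : ∀ a b d, f a ≤ d → d ≤ f b → ∃ e, d = f e) {c : Cut β} (hc : c ≠ ⊥) (F : Cut α → Prop) :
    (∀ c' < f c, ∃ d ∈ Set.Ioo c' (f c), F d) ↔ ∀ c' < c, ∃ d ∈ Set.Ioo c' c, F (f d) := by
  constructor
  · intro h c' hc'
    obtain ⟨d, hd, hF⟩ := h (f c') (f.lt_iff_lt.2 hc')
    obtain ⟨e, rfl⟩ := hf c' c d hd.1.le hd.2.le
    exact ⟨e, ⟨f.lt_iff_lt.1 hd.1, f.lt_iff_lt.1 hd.2⟩, hF⟩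
  · intro h c' hc'
    rcases le_or_gt (f ⊥) c' with h' | h'
    · obtain ⟨e, rfl⟩ := hf ⊥ c c' h' hc'.le
      obtain ⟨d, hd, hF⟩ := h e (f.lt_iff_lt.1 hc')
      exact ⟨f d, ⟨f.lt_iff_lt.2 hd.1, f.lt_iff_lt.2 hd.2⟩, hF⟩
    · obtain ⟨d, hd, hF⟩ := h ⊥ (bot_lt_iff_ne_bot.2 hc)
      exact ⟨f d, ⟨h'.trans (f.lt_iff_lt.2 hd.1), f.lt_iff_lt.2 hd.2⟩, hF⟩

theorem cofinal_right_comp (f : Cut β ↪o Cut α)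
    (hf : ∀ a b d, f a ≤ d → d ≤ f b → ∃ e, d = f e) {c : Cut β} (hc : c ≠ ⊤) (F : Cut α → Prop) :
    (∀ c', f c < c' → ∃ d ∈ Set.Ioo (f c) c', F d) ↔
      ∀ c', c < c' → ∃ d ∈ Set.Ioo c c', F (f d) := by
  constructor
  · intro h c' hc'
    obtain ⟨d, hd, hF⟩ := h (f c') (f.lt_iff_lt.2 hc')
    obtain ⟨e, rfl⟩ := hf c c' d hd.1.le hd.2.le
    exact ⟨e, ⟨f.lt_iff_lt.1 hd.1, f.lt_iff_lt.1 hd.2⟩, hF⟩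
  · intro h c' hc'
    rcases le_or_gt c' (f ⊤) with h' | h'
    · obtain ⟨e, rfl⟩ := hf c ⊤ c' hc'.le h'
      obtain ⟨d, hd, hF⟩ := h e (f.lt_iff_lt.1 hc')
      exact ⟨f d, ⟨f.lt_iff_lt.2 hd.1, f.lt_iff_lt.2 hd.2⟩, hF⟩
    · obtain ⟨d, hd, hF⟩ := h ⊤ (lt_top_iff_ne_top.2 hc)
      exact ⟨f d, ⟨f.lt_iff_lt.2 hd.1, (f.lt_iff_lt.2 hd.2).trans h'⟩, hF⟩

end Cut

namespace PriorityAutomaton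

variable {Q : Type v} {A : Type u} {α β : Type*} [LinearOrder α] [LinearOrder β]

/-- The condition that a run has to satisfy at `c` if it is a left limit. -/
def LeftCondition (M : PriorityAutomaton Q A) (ρ : Cut α → Q) (c : Cut α) : Prop :=
  c.IsLeftLimit →
    ∃ k, IsGreatest (⋂ c' ∈ Set.Iio c, M.prio '' (ρ '' Set.Ioo c' c)) k ∧ (k, ρ c) ∈ M.leftTrans

/-- The condition that a run has to satisfy at `c` if it is a right limit. -/
def RightCondition (M : PriorityAutomaton Q A) (ρ : Cut α → Q) (c : Cut α) : Prop :=
  c.IsRightLimit →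
    ∃ k, IsGreatest (⋂ c' ∈ Set.Ioi c, M.prio '' (ρ '' Set.Ioo c c')) k ∧ (ρ c, k) ∈ M.rightTrans

theorem LeftCondition.congr {M : PriorityAutomaton Q A} {ρ : Cut α → Q} {ρ' : Cut β → Q}
    {c : Cut α} {c' : Cut β} (h : M.LeftCondition ρ c) (hc : c'.IsLeftLimit → c.IsLeftLimit)
    (he : ρ' c' = ρ c) (hk : c'.IsLeftLimit → ∀ q : Set.Icc 1 M.N,
      (∀ a < c', ∃ d ∈ Set.Ioo a c', M.prio (ρ' d) = q) ↔
        ∀ a < c, ∃ d ∈ Set.Ioo a c, M.prio (ρ d) = q) : M.LeftCondition ρ' c' := by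
  intro hc'
  obtain ⟨k, h1, h2⟩ := h (hc hc')
  refine ⟨k, ?_, he ▸ h2⟩
  convert h1 using 1
  ext q
  rw [mem_limit_left, mem_limit_left, hk hc' q]

theorem RightCondition.congr {M : PriorityAutomaton Q A} {ρ : Cut α → Q} {ρ' : Cut β → Q}
    {c : Cut α} {c' : Cut β} (h : M.RightCondition ρ c) (hc : c'.IsRightLimit → c.IsRightLimit)
    (he : ρ' c' = ρ c) (hk : c'.IsRightLimit → ∀ q : Set.Icc 1 M.N,
      (∀ a, c' < a → ∃ d ∈ Set.Ioo c' a, M.prio (ρ' d) = q) ↔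
        ∀ a, c < a → ∃ d ∈ Set.Ioo c a, M.prio (ρ d) = q) : M.RightCondition ρ' c' := by
  intro hc'
  obtain ⟨k, h1, h2⟩ := h (hc hc')
  refine ⟨k, ?_, he ▸ h2⟩
  convert h1 using 1
  ext q
  rw [mem_limit_right, mem_limit_right, hk hc' q]

/-- The condition only looks at arbitrarily small left neighbourhoods. As `f` has convex image and
`c ≠ ⊥`, those of `f c` are images of those of `c`. -/
theorem leftCondition_comp {M : PriorityAutomaton Q A} {ρ : Cut α → Q} (f : Cut β ↪o Cut α)
    (hf : ∀ a b d, f a ≤ d → d ≤ f b → ∃ e, d = f e) {c : Cut β} (hc : c ≠ ⊥) :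
    M.LeftCondition ρ (f c) ↔ M.LeftCondition (fun c => ρ (f c)) c := by
  have hl : (f c).IsLeftLimit ↔ c.IsLeftLimit := by
    rw [Cut.isLeftLimit_iff, Cut.isLeftLimit_iff,
      Cut.cofinal_left_comp f hf hc fun _ => True]
    refine and_congr_left' (iff_of_true ?_ hc)
    exact (bot_le.trans_lt (f.lt_iff_lt.2 (bot_lt_iff_ne_bot.2 hc))).ne'
  exact ⟨fun h => h.congr hl.2 rfl fun _ q =>
      (Cut.cofinal_left_comp f hf hc fun d => M.prio (ρ d) = q).symm,
    fun h => h.congr hl.1 rfl fun _ q =>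
      Cut.cofinal_left_comp f hf hc fun d => M.prio (ρ d) = q⟩

theorem rightCondition_comp {M : PriorityAutomaton Q A} {ρ : Cut α → Q} (f : Cut β ↪o Cut α)
    (hf : ∀ a b d, f a ≤ d → d ≤ f b → ∃ e, d = f e) {c : Cut β} (hc : c ≠ ⊤) :
    M.RightCondition ρ (f c) ↔ M.RightCondition (fun c => ρ (f c)) c := by
  have hl : (f c).IsRightLimit ↔ c.IsRightLimit := by
    rw [Cut.isRightLimit_iff, Cut.isRightLimit_iff,
      Cut.cofinal_right_comp f hf hc fun _ => True]
    refine and_congr_left' (iff_of_true ?_ hc)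
    exact ((f.lt_iff_lt.2 (lt_top_iff_ne_top.2 hc)).trans_le le_top).ne
  exact ⟨fun h => h.congr hl.2 rfl fun _ q =>
      (Cut.cofinal_right_comp f hf hc fun d => M.prio (ρ d) = q).symm,
    fun h => h.congr hl.1 rfl fun _ q =>
      Cut.cofinal_right_comp f hf hc fun d => M.prio (ρ d) = q⟩

/-- The restriction of a run to an interval of cuts. -/
theorem IsRun.comp {M : PriorityAutomaton Q A} {u : α → A} {ρ : Cut α → Q} (hρ : M.IsRun u ρ)
    (f : Cut β ↪o Cut α) (hf : ∀ a b d, f a ≤ d → d ≤ f b → ∃ e, d = f e) (m : β → α)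
    (hb : ∀ x, f (Cut.before x) = Cut.before (m x)) (ha : ∀ x, f (Cut.after x) = Cut.after (m x)) :
    M.IsRun (fun x => u (m x)) fun c => ρ (f c) where
  letter x := by
    rw [hb, ha]
    exact hρ.letter (m x)
  left c hc := (leftCondition_comp f hf hc.1).1 (hρ.left (f c)) hc
  right c hc := (rightCondition_comp f hf hc.1).1 (hρ.right (f c)) hc

/-- The end states and the visited states of the runs over a word, together with its
non-emptiness. -/
def profile (M : PriorityAutomaton Q A) (u : α → A) : Set (Q × Q × Set Q) × Prop :=
  ({t | ∃ ρ, M.IsRun u ρ ∧ t = (ρ ⊥, ρ ⊤, Set.range ρ)}, Nonempty α)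

theorem profile_subset_of_iso (M : PriorityAutomaton Q A) {u : α → A} {v : β → A} (e : α ≃o β)
    (h : ∀ x, v (e x) = u x) : (M.profile u).1 ⊆ (M.profile v).1 := by
  rintro _ ⟨ρ, hρ, rfl⟩
  let f : Cut β ≃o Cut α := LowerSet.map e.symm
  refine ⟨fun c => ρ (f c), ?_, ?_⟩
  · have := hρ.comp f.toOrderEmbedding (fun _ _ d _ _ => ⟨f.symm d, (f.apply_symm_apply d).symm⟩)
      e.symm (fun x => by simp [f, Cut.before]) (fun x => by simp [f, Cut.after])
    obtain rfl : v = fun x => u (e.symm x) := funext fun x => by rw [← h, e.apply_symm_apply]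
    exact this
  · change _ = (ρ (f ⊥), ρ (f ⊤), Set.range (ρ ∘ f))
    rw [f.map_bot, f.map_top, f.surjective.range_comp ρ]

theorem profile_eq_of_iso (M : PriorityAutomaton Q A) {u : α → A} {v : β → A} (e : α ≃o β)
    (h : ∀ x, v (e x) = u x) : M.profile u = M.profile v :=
  Prod.ext ((M.profile_subset_of_iso e h).antisymm (M.profile_subset_of_iso e.symm fun x => by
    rw [← h, e.apply_symm_apply])) (propext e.toEquiv.nonempty_congr)

end PriorityAutomaton

/-! ### Cuts of a sum of orderings -/

namespace SigmaLex

variable {ι : Type*} [LinearOrder ι] {β γ : ι → Type*} [∀ i, LinearOrder (β i)]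
  [∀ i, LinearOrder (γ i)]

/-- The point `b` of the `i`-th summand. -/
abbrev pt (i : ι) (b : β i) : Σₗ i, β i := toLex ⟨i, b⟩

theorem pt_lt_of_lt {i j : ι} (h : i < j) (a : β i) (b : β j) : pt i a < pt j b :=
  Sigma.Lex.left _ _ h

theorem pt_le_iff {i : ι} {a b : β i} : pt i a ≤ pt i b ↔ a ≤ b := by
  constructor
  · intro h
    have h' : Sigma.Lex (· < ·) (fun i => ((· ≤ ·) : β i → β i → Prop)) ⟨i, a⟩ ⟨i, b⟩ := h
    cases h' with
    | left _ _ h => exact (lt_irrefl _ h).elim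
    | right _ _ h => exact h
  · exact fun h => Sigma.Lex.right _ _ h

theorem pt_lt_iff {i : ι} {a b : β i} : pt i a < pt i b ↔ a < b := by
  rw [← not_le, ← not_le, pt_le_iff]

theorem le_of_pt_le {i j : ι} {a : β i} {b : β j} (h : pt i a ≤ pt j b) : i ≤ j :=
  not_lt.1 fun hji => h.not_gt (pt_lt_of_lt hji b a)

/-- The cut of the sum given by a cut of the `i`-th summand. -/
def inc (i : ι) (c : Cut (β i)) : Cut (Σₗ i, β i) where
  carrier := {x | (ofLex x).1 < i ∨ ∃ b ∈ c, x = pt i b}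
  lower' := by
    rintro ⟨j, b⟩ ⟨k, a⟩ hab hb
    have hkj := le_of_pt_le hab
    rcases lt_or_eq_of_le hkj with hkj | rfl
    · rcases hb with hb | ⟨b', -, hb⟩
      · exact .inl (hkj.trans hb)
      · obtain rfl : j = i := congrArg (fun x => (ofLex x).1) hb
        exact .inl hkj
    · rcases hb with hb | ⟨b', hb', hb⟩
      · exact .inl hb
      · obtain rfl : k = i := congrArg (fun x => (ofLex x).1) hb
        have hb : pt k b = pt k b' := hb
        obtain rfl : b = b' := by simpa using hb
        exact .inr ⟨a, c.lower (pt_le_iff.1 hab) hb', rfl⟩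

theorem pt_mem_inc {i : ι} {c : Cut (β i)} {b : β i} : pt i b ∈ inc i c ↔ b ∈ c := by
  constructor
  · rintro (h | ⟨b', hb', h⟩)
    · exact (lt_irrefl _ h).elim
    · obtain rfl : b = b' := by simpa using h
      exact hb'
  · exact fun h => .inr ⟨b, h, rfl⟩

theorem pt_mem_inc_of_lt {i j : ι} (h : j < i) (c : Cut (β i)) (b : β j) : pt j b ∈ inc i c :=
  .inl h

theorem le_of_pt_mem_inc {i j : ι} {c : Cut (β i)} {b : β j} (h : pt j b ∈ inc i c) : j ≤ i := by
  rcases h with h | ⟨b', -, h⟩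
  · exact h.le
  · exact (congrArg (fun x => (ofLex x).1) h : j = i).le

/-- The trace of a cut on the `i`-th summand. -/
def trace (i : ι) (d : Cut (Σₗ i, β i)) : Cut (β i) where
  carrier := {b | pt i b ∈ d}
  lower' _ _ hab hb := d.lower (pt_le_iff.2 hab) hb

theorem inc_le_inc {i : ι} {c c' : Cut (β i)} : inc i c ≤ inc i c' ↔ c ≤ c' := by
  constructor
  · exact fun h b hb => pt_mem_inc.1 (h (pt_mem_inc.2 hb))
  · rintro h ⟨j, b⟩ hb
    have hji := le_of_pt_mem_inc hb
    rcases lt_or_eq_of_le hji with hji | rfl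
    · exact pt_mem_inc_of_lt hji _ _
    · exact pt_mem_inc.2 (h (pt_mem_inc.1 hb))

/-- The embedding of the cuts of a summand into the cuts of the sum. -/
def incEmb (i : ι) : Cut (β i) ↪o Cut (Σₗ i, β i) :=
  OrderEmbedding.ofMapLEIff (inc i) fun _ _ => inc_le_inc

theorem eq_inc_trace {i : ι} {d : Cut (Σₗ i, β i)} (h1 : ∀ j < i, ∀ b : β j, pt j b ∈ d)
    (h2 : ∀ j > i, ∀ b : β j, pt j b ∉ d) : d = inc i (trace i d) := by
  ext ⟨j, b⟩
  change pt j b ∈ d ↔ pt j b ∈ inc i (trace i d)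
  rcases lt_trichotomy j i with h | rfl | h
  · exact iff_of_true (h1 j h b) (pt_mem_inc_of_lt h _ _)
  · exact (pt_mem_inc (c := trace j d) (b := b)).symm
  · exact iff_of_false (h2 j h b) fun h' => (le_of_pt_mem_inc h').not_gt h

theorem inc_convex (i : ι) (a b : Cut (β i)) (d : Cut (Σₗ i, β i)) (h1 : incEmb i a ≤ d)
    (h2 : d ≤ incEmb i b) : ∃ e, d = incEmb i e :=
  ⟨trace i d, eq_inc_trace (fun _ h _ => h1 (pt_mem_inc_of_lt h _ _)) fun _ h _ h' =>
    (le_of_pt_mem_inc (h2 h')).not_gt h⟩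

theorem inc_before (i : ι) (b : β i) : inc i (Cut.before b) = Cut.before (pt i b) := by
  ext ⟨j, a⟩
  change pt j a ∈ inc i (Cut.before b) ↔ pt j a < pt i b
  rcases lt_trichotomy j i with h | rfl | h
  · exact iff_of_true (pt_mem_inc_of_lt h _ _) (pt_lt_of_lt h _ _)
  · rw [pt_mem_inc, pt_lt_iff]; rfl
  · exact iff_of_false (fun h' => (le_of_pt_mem_inc h').not_gt h) (pt_lt_of_lt h _ _).not_gt

theorem inc_after (i : ι) (b : β i) : inc i (Cut.after b) = Cut.after (pt i b) := by
  ext ⟨j, a⟩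
  change pt j a ∈ inc i (Cut.after b) ↔ pt j a ≤ pt i b
  rcases lt_trichotomy j i with h | rfl | h
  · exact iff_of_true (pt_mem_inc_of_lt h _ _) (pt_lt_of_lt h _ _).le
  · rw [pt_mem_inc, pt_le_iff]; rfl
  · exact iff_of_false (fun h' => (le_of_pt_mem_inc h').not_gt h) (pt_lt_of_lt h _ _).not_ge

/-- A cut that does not split any summand. -/
def IsSaturated (d : Cut (Σₗ i, β i)) : Prop :=
  ∀ (i : ι) (a b : β i), pt i a ∈ d → pt i b ∈ d

/-- The cut of another sum that meets the same summands. -/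
def transfer (hne : ∀ i, Nonempty (β i) → Nonempty (γ i)) (d : Cut (Σₗ i, γ i)) :
    Cut (Σₗ i, β i) where
  carrier := {x | ∃ y, pt (ofLex x).1 y ∈ d}
  lower' := by
    rintro ⟨j, b⟩ ⟨k, a⟩ hab ⟨y, hy⟩
    rcases lt_or_eq_of_le (le_of_pt_le hab) with hkj | rfl
    · obtain ⟨z⟩ := hne k ⟨a⟩
      exact ⟨z, d.lower (pt_lt_of_lt hkj z y).le hy⟩
    · exact ⟨y, hy⟩

variable {hne : ∀ i, Nonempty (β i) → Nonempty (γ i)}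
  {hne' : ∀ i, Nonempty (γ i) → Nonempty (β i)}

theorem pt_mem_transfer {d : Cut (Σₗ i, γ i)} {i : ι} {b : β i} :
    pt i b ∈ transfer hne d ↔ ∃ y, pt i y ∈ d := Iff.rfl

theorem transfer_transfer {c : Cut (Σₗ i, β i)} (hc : IsSaturated c) :
    transfer hne (transfer hne' c) = c := by
  ext ⟨i, b⟩
  change (∃ y : γ i, ∃ b' : β i, pt i b' ∈ c) ↔ pt i b ∈ c
  constructor
  · rintro ⟨-, b', hb⟩
    exact hc i b' b hb
  · intro hb
    obtain ⟨y⟩ := hne i ⟨b⟩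
    exact ⟨y, b, hb⟩

theorem isSaturated_transfer (d : Cut (Σₗ i, γ i)) : IsSaturated (transfer hne d) :=
  fun _ _ _ h => h

theorem eq_inc_of_not_last {i : ι} {x : β i} {d : Cut (Σₗ i, β i)} (hx : pt i x ∈ d)
    (h : ∀ (j : ι) (y : β j), i < j → pt j y ∉ d) : ∃ e, e ≠ ⊥ ∧ d = incEmb i e := by
  refine ⟨trace i d, fun h' => ?_, eq_inc_trace
    (fun j hj b => d.lower (pt_lt_of_lt hj b x).le hx) fun j hj b => h j b hj⟩
  have hx' : x ∈ trace i d := hx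
  rw [h'] at hx'
  exact hx'

theorem eq_inc_of_not_first {i : ι} {x : β i} {d : Cut (Σₗ i, β i)} (hx : pt i x ∉ d)
    (h : ∀ (j : ι) (y : β j), j < i → pt j y ∈ d) : ∃ e, e ≠ ⊤ ∧ d = incEmb i e := by
  refine ⟨trace i d, fun h' => ?_, eq_inc_trace (fun j hj b => h j b hj)
    fun j hj b hb => hx (d.lower (pt_lt_of_lt hj x b).le hb)⟩
  have hx' : x ∉ trace i d := hx
  rw [h'] at hx'
  exact hx' trivial

theorem isSaturated_or (d : Cut (Σₗ i, β i)) : IsSaturated d ∨ ∃ i e, d = incEmb i e := by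
  by_cases h : IsSaturated d
  · exact .inl h
  · unfold IsSaturated at h
    push Not at h
    obtain ⟨i, a, b, ha, hb⟩ := h
    exact .inr ⟨i, trace i d, eq_inc_trace (fun j hj c => d.lower (pt_lt_of_lt hj c a).le ha)
      fun j hj c hc => hb (d.lower (pt_lt_of_lt hj b c).le hc)⟩

/-- If `d` meets a last summand, its left neighbourhoods live in that summand; otherwise each
summand met by `d` is followed by another, hence contained in `d`. -/
theorem left_cases (d : Cut (Σₗ i, β i)) : (∃ i e, e ≠ ⊥ ∧ d = incEmb i e) ∨
    (IsSaturated d ∧ ∀ (i : ι) (a : β i), pt i a ∈ d → ∃ (j : ι) (b : β j), i < j ∧ pt j b ∈ d) := by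
  by_cases h : ∀ (i : ι) (a : β i), pt i a ∈ d → ∃ (j : ι) (b : β j), i < j ∧ pt j b ∈ d
  · refine .inr ⟨fun i a b ha => ?_, h⟩
    obtain ⟨j, c, hij, hc⟩ := h i a ha
    exact d.lower (pt_lt_of_lt hij b c).le hc
  · push Not at h
    obtain ⟨i, a, ha, h⟩ := h
    exact .inl ⟨i, eq_inc_of_not_last ha h⟩

theorem right_cases (d : Cut (Σₗ i, β i)) : (∃ i e, e ≠ ⊤ ∧ d = incEmb i e) ∨
    (IsSaturated d ∧ ∀ (i : ι) (a : β i), pt i a ∉ d → ∃ (j : ι) (b : β j), j < i ∧ pt j b ∉ d) := by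
  by_cases h : ∀ (i : ι) (a : β i), pt i a ∉ d → ∃ (j : ι) (b : β j), j < i ∧ pt j b ∉ d
  · refine .inr ⟨fun i a b ha => ?_, h⟩
    by_contra hb
    obtain ⟨j, c, hij, hc⟩ := h i b hb
    exact hc (d.lower (pt_lt_of_lt hij c a).le ha)
  · push Not at h
    obtain ⟨i, a, ha, h⟩ := h
    exact .inl ⟨i, eq_inc_of_not_first ha h⟩

/-- Two cuts of sums along the same ordering are close if they differ by at most one summand. -/
def Close (c : Cut (Σₗ i, β i)) (d : Cut (Σₗ i, γ i)) : Prop :=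
  (∀ (i j : ι) (b : β i) (y : γ j), i < j → pt j y ∈ d → pt i b ∈ c) ∧
    ∀ (i j : ι) (y : γ i) (b : β j), i < j → pt j b ∈ c → pt i y ∈ d

theorem Close.symm {c : Cut (Σₗ i, β i)} {d : Cut (Σₗ i, γ i)} (h : Close c d) : Close d c :=
  ⟨h.2, h.1⟩

theorem close_transfer (d : Cut (Σₗ i, γ i)) : Close (transfer hne d) d := by
  refine ⟨fun i j b y hij hy => ?_, fun i j y b hij ⟨z, hz⟩ => ?_⟩
  · obtain ⟨z⟩ := hne i ⟨b⟩
    exact ⟨z, d.lower (pt_lt_of_lt hij z y).le hy⟩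
  · exact d.lower (pt_lt_of_lt hij y z).le hz

theorem close_inc (i : ι) (e : Cut (β i)) (e' : Cut (γ i)) : Close (inc i e) (inc i e') :=
  ⟨fun _ _ _ _ hij hy => pt_mem_inc_of_lt (hij.trans_le (le_of_pt_mem_inc hy)) _ _,
    fun _ _ _ _ hij hy => pt_mem_inc_of_lt (hij.trans_le (le_of_pt_mem_inc hy)) _ _⟩

/-- At a limit of summands, an error of one summand is absorbed by moving on to a later summand. -/
theorem cofinal_left_of_close {F : Cut (Σₗ i, β i) → Prop} {G : Cut (Σₗ i, γ i) → Prop}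
    (hFG : ∀ c, F c → ∃ d, G d ∧ Close c d) {c₀ : Cut (Σₗ i, β i)} {d₀ : Cut (Σₗ i, γ i)}
    (hcd : ∀ (i : ι) (y : γ i), pt i y ∈ d₀ ↔ ∃ b : β i, pt i b ∈ c₀)
    (hne : ∀ i, Nonempty (β i) → Nonempty (γ i))
    (hlast : ∀ (i : ι) (a : β i), pt i a ∈ c₀ → ∃ (j : ι) (b : β j), i < j ∧ pt j b ∈ c₀)
    (h : ∀ c' < c₀, ∃ c ∈ Set.Ioo c' c₀, F c) : ∀ d' < d₀, ∃ d ∈ Set.Ioo d' d₀, G d := by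
  intro d' hd'
  obtain ⟨⟨i, y⟩, h1, h2⟩ := Cut.mem_of_lt hd'
  obtain ⟨b, hb⟩ := (hcd i y).1 (Cut.after_le_iff.1 h2)
  obtain ⟨j, bj, hij, hbj⟩ := hlast i b hb
  -- Summand `j` leaves room for the error of closeness; summand `k` makes the cut after `bj`
  -- strictly smaller than `c₀`.
  obtain ⟨k, bk, hjk, hbk⟩ := hlast j bj hbj
  have hlt : Cut.after (pt j bj) < c₀ := lt_of_le_of_ne (Cut.after_le_iff.2 hbj) fun he => by
    rw [← he] at hbk
    exact (pt_lt_of_lt hjk bj bk).not_ge hbk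
  obtain ⟨c, hc, hF⟩ := h _ hlt
  obtain ⟨d, hG, hcl⟩ := hFG c hF
  refine ⟨d, ⟨h1.trans_lt ((Cut.before_lt_after _).trans_le (Cut.after_le_iff.2 ?_)), ?_⟩, hG⟩
  · exact hcl.2 i j y bj hij (Cut.after_le_iff.1 hc.1.le)
  · obtain ⟨⟨m, bm⟩, h3, h4⟩ := Cut.mem_of_lt hc.2
    have hm : pt m bm ∉ c := Cut.le_before_iff.1 h3
    obtain ⟨n, bn, hmn, hbn⟩ := hlast m bm (Cut.after_le_iff.1 h4)
    obtain ⟨z⟩ := hne n ⟨bn⟩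
    refine lt_of_not_ge fun hle => hm (hcl.1 m n bm z hmn (hle ((hcd n z).2 ⟨bn, hbn⟩)))

theorem cofinal_right_of_close {F : Cut (Σₗ i, β i) → Prop} {G : Cut (Σₗ i, γ i) → Prop}
    (hFG : ∀ c, F c → ∃ d, G d ∧ Close c d) {c₀ : Cut (Σₗ i, β i)} {d₀ : Cut (Σₗ i, γ i)}
    (hcd : ∀ (i : ι) (y : γ i), pt i y ∉ d₀ ↔ ∃ b : β i, pt i b ∉ c₀)
    (hne : ∀ i, Nonempty (β i) → Nonempty (γ i))
    (hfirst : ∀ (i : ι) (a : β i), pt i a ∉ c₀ → ∃ (j : ι) (b : β j), j < i ∧ pt j b ∉ c₀)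
    (h : ∀ c', c₀ < c' → ∃ c ∈ Set.Ioo c₀ c', F c) :
    ∀ d', d₀ < d' → ∃ d ∈ Set.Ioo d₀ d', G d := by
  intro d' hd'
  obtain ⟨⟨i, y⟩, h1, h2⟩ := Cut.mem_of_lt hd'
  obtain ⟨b, hb⟩ := (hcd i y).1 (Cut.le_before_iff.1 h1)
  obtain ⟨j, bj, hij, hbj⟩ := hfirst i b hb
  obtain ⟨k, bk, hjk, hbk⟩ := hfirst j bj hbj
  have hlt : c₀ < Cut.before (pt j bj) := lt_of_le_of_ne (Cut.le_before_iff.2 hbj) fun he => by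
    rw [he] at hbk
    exact hbk (pt_lt_of_lt hjk bk bj)
  obtain ⟨c, hc, hF⟩ := h _ hlt
  obtain ⟨d, hG, hcl⟩ := hFG c hF
  refine ⟨d, ⟨?_, ((Cut.le_before_iff.2 ?_).trans_lt (Cut.before_lt_after _)).trans_le h2⟩, hG⟩
  · obtain ⟨⟨m, bm⟩, h3, h4⟩ := Cut.mem_of_lt hc.1
    have hm : pt m bm ∈ c := Cut.after_le_iff.1 h4
    obtain ⟨n, bn, hmn, hbn⟩ := hfirst m bm (Cut.le_before_iff.1 h3)
    obtain ⟨z⟩ := hne n ⟨bn⟩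
    exact lt_of_not_ge fun hle => (hcd n z).2 ⟨bn, hbn⟩ (hle (hcl.2 n m z bm hmn hm))
  · exact fun hd => Cut.le_before_iff.1 hc.2.le (hcl.1 j i bj y hij hd)

end SigmaLex

/-! ### Profiles are compatible with sums -/

namespace PriorityAutomaton

open SigmaLex

variable {Q : Type v} {A : Type u} {ι : Type*} [LinearOrder ι] {β γ : ι → Type*}
  [∀ i, LinearOrder (β i)] [∀ i, LinearOrder (γ i)]

/-- The runs on the summands of a sum may be exchanged for runs on the summands of another sum. -/
theorem IsRun.exchange {M : PriorityAutomaton Q A} {u : ∀ i, β i → A} {v : ∀ i, γ i → A}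
    (hne : ∀ i, Nonempty (β i) ↔ Nonempty (γ i)) {ρ : Cut (Σₗ i, β i) → Q}
    (hρ : M.IsRun (fun x => u (ofLex x).1 (ofLex x).2) ρ) (σ : ∀ i, Cut (γ i) → Q)
    (hσ : ∀ i, M.IsRun (v i) (σ i)) (hbot : ∀ i, σ i ⊥ = ρ (inc i ⊥))
    (htop : ∀ i, σ i ⊤ = ρ (inc i ⊤))
    (hrange : ∀ i, Set.range (σ i) = Set.range fun c => ρ (inc i c)) :
    ∃ ρ' : Cut (Σₗ i, γ i) → Q, M.IsRun (fun x => v (ofLex x).1 (ofLex x).2) ρ' ∧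
      ρ' ⊥ = ρ ⊥ ∧ ρ' ⊤ = ρ ⊤ ∧ Set.range ρ' = Set.range ρ := by
  classical
  have hn1 := fun i => (hne i).1
  have hn2 := fun i => (hne i).2
  -- A cut properly inside a summand takes its state from the run on that summand; any other cut
  -- takes the state of `ρ` at the cut meeting the same summands. `hinc` shows that both rules agree
  -- at the ends of summands.
  let ρ' : Cut (Σₗ i, γ i) → Q := fun d =>
    if h : ∃ i, (∃ x : γ i, pt i x ∈ d) ∧ ∃ y : γ i, pt i y ∉ d then σ h.choose (trace h.choose d)
    else ρ (transfer hn1 d)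
  have hsat : ∀ d, IsSaturated d → ρ' d = ρ (transfer hn1 d) := fun d hd =>
    dif_neg fun ⟨i, ⟨x, hx⟩, y, hy⟩ => hy (hd i x y hx)
  have hinc : ∀ i e, ρ' (inc i e) = σ i e := by
    intro i e
    by_cases h : ∃ j, (∃ x : γ j, pt j x ∈ inc i e) ∧ ∃ y : γ j, pt j y ∉ inc i e
    · have hj := h.choose_spec
      have hval : ρ' (inc i e) = σ h.choose (trace h.choose (inc i e)) := dif_pos h
      rw [hval]
      obtain ⟨⟨x, hx⟩, y, hy⟩ := hj
      have : h.choose = i := le_antisymm (le_of_pt_mem_inc hx)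
        (not_lt.1 fun hlt => hy (pt_mem_inc_of_lt hlt _ _))
      rw [this]
      congr 1
      ext z
      exact pt_mem_inc
    · have hval : ρ' (inc i e) = ρ (transfer hn1 (inc i e)) := dif_neg h
      rw [hval]
      rw [not_exists] at h
      have he : e = ⊥ ∨ e = ⊤ := by
        by_cases he : e = ⊥
        · exact .inl he
        · obtain ⟨x, -, hx⟩ := Cut.mem_of_lt (bot_lt_iff_ne_bot.2 he)
          refine .inr (eq_top_iff.2 fun y _ => ?_)
          by_contra hy
          exact h i ⟨⟨x, pt_mem_inc.2 (Cut.after_le_iff.1 hx)⟩, y, fun h' => hy (pt_mem_inc.1 h')⟩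
      rcases he with rfl | rfl
      · rw [hbot]
        congr 1
        ext ⟨j, b⟩
        change (∃ y : γ j, pt j y ∈ inc i ⊥) ↔ pt j b ∈ inc i ⊥
        rcases lt_trichotomy j i with hji | rfl | hji
        · obtain ⟨y⟩ := hn1 j ⟨b⟩
          exact iff_of_true ⟨y, pt_mem_inc_of_lt hji _ _⟩ (pt_mem_inc_of_lt hji _ _)
        · exact iff_of_false (fun ⟨y, hy⟩ => pt_mem_inc.1 hy) fun hb => pt_mem_inc.1 hb
        · exact iff_of_false (fun ⟨y, hy⟩ => (le_of_pt_mem_inc hy).not_gt hji)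
            fun hb => (le_of_pt_mem_inc hb).not_gt hji
      · rw [htop]
        congr 1
        ext ⟨j, b⟩
        change (∃ y : γ j, pt j y ∈ inc i ⊤) ↔ pt j b ∈ inc i ⊤
        rcases lt_trichotomy j i with hji | rfl | hji
        · obtain ⟨y⟩ := hn1 j ⟨b⟩
          exact iff_of_true ⟨y, pt_mem_inc_of_lt hji _ _⟩ (pt_mem_inc_of_lt hji _ _)
        · obtain ⟨y⟩ := hn1 j ⟨b⟩
          exact iff_of_true ⟨y, pt_mem_inc.2 trivial⟩ (pt_mem_inc.2 trivial)
        · exact iff_of_false (fun ⟨y, hy⟩ => (le_of_pt_mem_inc hy).not_gt hji)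
            fun hb => (le_of_pt_mem_inc hb).not_gt hji
  -- Equality of the visited sets lets each state of one run be found in the other within the same
  -- summand; `hback` and `hforth` transfer recurrence at limits of summands as well as the set of
  -- visited states.
  have hback : ∀ d, ∃ c, ρ c = ρ' d ∧ Close c d := by
    intro d
    rcases isSaturated_or d with hd | ⟨i, e, rfl⟩
    · exact ⟨transfer hn1 d, (hsat d hd).symm, close_transfer d⟩
    · obtain ⟨e', he'⟩ : σ i e ∈ Set.range fun c => ρ (inc i c) := hrange i ▸ ⟨e, rfl⟩
      exact ⟨inc i e', he'.trans (hinc i e).symm, close_inc i e' e⟩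
  have hforth : ∀ c, ∃ d, ρ' d = ρ c ∧ Close c d := by
    intro c
    rcases isSaturated_or c with hc | ⟨i, e, rfl⟩
    · refine ⟨transfer hn2 c, ?_, (close_transfer c).symm⟩
      rw [hsat _ (isSaturated_transfer c), transfer_transfer hc]
    · obtain ⟨e', he'⟩ : ρ (inc i e) ∈ Set.range (σ i) := hrange i ▸ ⟨e, rfl⟩
      exact ⟨inc i e', (hinc i e').trans he', close_inc i e e'⟩
  have hsatT : ∀ (d : Cut (Σₗ i, γ i)), IsSaturated d → ∀ i (y : γ i),
      pt i y ∈ d ↔ ∃ b : β i, pt i b ∈ transfer hn1 d := by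
    intro d hd i y
    obtain ⟨b⟩ := hn2 i ⟨y⟩
    exact ⟨fun h => ⟨b, y, h⟩, fun ⟨_, z, hz⟩ => hd i z y hz⟩
  have hsatN : ∀ (d : Cut (Σₗ i, γ i)), IsSaturated d → ∀ i (y : γ i),
      pt i y ∉ d ↔ ∃ b : β i, pt i b ∉ transfer hn1 d := by
    intro d hd i y
    obtain ⟨b⟩ := hn2 i ⟨y⟩
    exact ⟨fun h => ⟨b, fun ⟨z, hz⟩ => h (hd i z y hz)⟩, fun ⟨_, hz⟩ h => hz ⟨y, h⟩⟩
  refine ⟨ρ', ⟨?_, ?_, ?_⟩, ?_, ?_, ?_⟩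
  · rintro ⟨i, x⟩
    have := (hσ i).letter x
    rw [← hinc, ← hinc, inc_before, inc_after] at this
    exact this
  · intro d
    change M.LeftCondition ρ' d
    rcases left_cases d with ⟨i, e, he, rfl⟩ | ⟨hd, hlast⟩
    · refine (leftCondition_comp (incEmb i) (inc_convex i) he).2 ?_
      have : (fun c => ρ' (incEmb i c)) = σ i := funext fun c => hinc i c
      rw [this]
      exact (hσ i).left e
    have hlast' : ∀ (i : ι) (a : β i), pt i a ∈ transfer hn1 d →
        ∃ (j : ι) (b : β j), i < j ∧ pt j b ∈ transfer hn1 d := by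
      rintro i a ⟨y, hy⟩
      obtain ⟨j, z, hij, hz⟩ := hlast i y hy
      obtain ⟨b⟩ := hn2 j ⟨z⟩
      exact ⟨j, b, hij, z, hz⟩
    have hlim : ∀ (F : Cut (Σₗ i, β i) → Prop) (G : Cut (Σₗ i, γ i) → Prop),
        (∀ c, F c → ∃ d, G d ∧ Close c d) → (∀ d, G d → ∃ c, F c ∧ Close d c) →
        ((∀ a < d, ∃ e ∈ Set.Ioo a d, G e) ↔
          ∀ a < transfer hn1 d, ∃ e ∈ Set.Ioo a (transfer hn1 d), F e) := by
      intro F G hFG hGF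
      exact ⟨cofinal_left_of_close hGF (fun i b => pt_mem_transfer) hn2 hlast,
        cofinal_left_of_close hFG (hsatT d hd) hn1 hlast'⟩
    refine LeftCondition.congr (hρ.left (transfer hn1 d)) ?_ (hsat d hd) fun _ q => ?_
    · rw [Cut.isLeftLimit_iff, Cut.isLeftLimit_iff]
      refine And.imp (fun h h' => h ?_) (hlim (fun _ => True) (fun _ => True)
        (fun c _ => (hforth c).imp fun _ h => ⟨trivial, h.2⟩)
        fun c _ => (hback c).imp fun _ h => ⟨trivial, h.2.symm⟩).1
      refine eq_bot_iff.2 fun ⟨i, y⟩ hy => ?_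
      obtain ⟨b, hb⟩ := (hsatT d hd i y).1 hy
      rw [h'] at hb
      exact hb
    · refine hlim (fun c => M.prio (ρ c) = q) _ (fun c hc => ?_) fun c hc => ?_
      · exact (hforth c).imp fun _ h => ⟨by rw [h.1, hc], h.2⟩
      · exact (hback c).imp fun _ h => ⟨by rw [h.1, hc], h.2.symm⟩
  · intro d
    change M.RightCondition ρ' d
    rcases right_cases d with ⟨i, e, he, rfl⟩ | ⟨hd, hfirst⟩
    · refine (rightCondition_comp (incEmb i) (inc_convex i) he).2 ?_
      have : (fun c => ρ' (incEmb i c)) = σ i := funext fun c => hinc i c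
      rw [this]
      exact (hσ i).right e
    have hN : ∀ (i : ι) (b : β i), pt i b ∉ transfer hn1 d ↔ ∃ y : γ i, pt i y ∉ d := by
      intro i b
      obtain ⟨z⟩ := hn1 i ⟨b⟩
      exact ⟨fun h => ⟨z, fun hz => h ⟨z, hz⟩⟩, fun ⟨y, hy⟩ ⟨x, hx⟩ => hy (hd i x y hx)⟩
    have hfirst' : ∀ (i : ι) (a : β i), pt i a ∉ transfer hn1 d →
        ∃ (j : ι) (b : β j), j < i ∧ pt j b ∉ transfer hn1 d := by
      intro i a ha
      obtain ⟨y, hy⟩ := (hN i a).1 ha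
      obtain ⟨j, z, hij, hz⟩ := hfirst i y hy
      obtain ⟨b⟩ := hn2 j ⟨z⟩
      exact ⟨j, b, hij, (hN j b).2 ⟨z, hz⟩⟩
    have hlim : ∀ (F : Cut (Σₗ i, β i) → Prop) (G : Cut (Σₗ i, γ i) → Prop),
        (∀ c, F c → ∃ d, G d ∧ Close c d) → (∀ d, G d → ∃ c, F c ∧ Close d c) →
        ((∀ a, d < a → ∃ e ∈ Set.Ioo d a, G e) ↔
          ∀ a, transfer hn1 d < a → ∃ e ∈ Set.Ioo (transfer hn1 d) a, F e) := by
      intro F G hFG hGF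
      exact ⟨cofinal_right_of_close hGF hN hn2 hfirst,
        cofinal_right_of_close hFG (hsatN d hd) hn1 hfirst'⟩
    refine RightCondition.congr (hρ.right (transfer hn1 d)) ?_ (hsat d hd) fun _ q => ?_
    · rw [Cut.isRightLimit_iff, Cut.isRightLimit_iff]
      refine And.imp (fun h h' => h ?_) (hlim (fun _ => True) (fun _ => True)
        (fun c _ => (hforth c).imp fun _ h => ⟨trivial, h.2⟩)
        fun c _ => (hback c).imp fun _ h => ⟨trivial, h.2.symm⟩).1
      refine eq_top_iff.2 fun ⟨i, y⟩ _ => ?_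
      by_contra hy
      obtain ⟨b, hb⟩ := (hsatN d hd i y).1 hy
      rw [h'] at hb
      exact hb trivial
    · refine hlim (fun c => M.prio (ρ c) = q) _ (fun c hc => ?_) fun c hc => ?_
      · exact (hforth c).imp fun _ h => ⟨by rw [h.1, hc], h.2⟩
      · exact (hback c).imp fun _ h => ⟨by rw [h.1, hc], h.2.symm⟩
  · rw [hsat _ fun _ _ _ h => h]
    congr 1
    exact eq_bot_iff.2 fun _ ⟨y, hy⟩ => hy
  · rw [hsat _ fun _ _ _ h => h]
    congr 1
    refine eq_top_iff.2 fun ⟨i, b⟩ _ => ?_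
    obtain ⟨y⟩ := hn1 i ⟨b⟩
    exact ⟨y, trivial⟩
  · ext q
    constructor
    · rintro ⟨d, rfl⟩
      exact (hback d).imp fun _ h => h.1
    · rintro ⟨c, rfl⟩
      exact (hforth c).imp fun _ h => h.1

/-- Restricting a run on the sum to each summand gives a triple in its profile, hence a run on the
matching summand to exchange. Emptiness must match too, since empty summands create no limit cuts.
-/
theorem profile_sigma_subset (M : PriorityAutomaton Q A) {u : ∀ i, β i → A} {v : ∀ i, γ i → A}
    (h : ∀ i, M.profile (u i) = M.profile (v i)) :
    (M.profile fun x : Σₗ i, β i => u (ofLex x).1 (ofLex x).2).1 ⊆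
      (M.profile fun x : Σₗ i, γ i => v (ofLex x).1 (ofLex x).2).1 := by
  rintro _ ⟨ρ, hρ, rfl⟩
  have hσ : ∀ i, ∃ σ, M.IsRun (v i) σ ∧ (ρ (inc i ⊥), ρ (inc i ⊤),
      Set.range fun c => ρ (inc i c)) = (σ ⊥, σ ⊤, Set.range σ) := by
    intro i
    change _ ∈ (M.profile (v i)).1
    rw [← h i]
    exact ⟨_, hρ.comp (incEmb i) (inc_convex i) (pt i) (inc_before i) (inc_after i), rfl⟩
  choose σ hσ hσ' using hσ
  obtain ⟨ρ', h1, h2, h3, h4⟩ := hρ.exchange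
    (fun i => iff_of_eq (congrArg Prod.snd (h i))) σ hσ
    (fun i => (congrArg Prod.fst (hσ' i)).symm) (fun i => (congrArg (·.2.1) (hσ' i)).symm)
    (fun i => (congrArg (·.2.2) (hσ' i)).symm)
  exact ⟨ρ', h1, by rw [h2, h3, h4]⟩

theorem profile_sigma_congr (M : PriorityAutomaton Q A) {u : ∀ i, β i → A} {v : ∀ i, γ i → A}
    (h : ∀ i, M.profile (u i) = M.profile (v i)) :
    (M.profile fun x : Σₗ i, β i => u (ofLex x).1 (ofLex x).2) =
      M.profile fun x : Σₗ i, γ i => v (ofLex x).1 (ofLex x).2 := by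
  refine Prod.ext ((M.profile_sigma_subset h).antisymm
    (M.profile_sigma_subset fun i => (h i).symm)) (propext ?_)
  have hne : ∀ i, Nonempty (β i) ↔ Nonempty (γ i) := fun i =>
    iff_of_eq (congrArg Prod.snd (h i))
  constructor
  · rintro ⟨⟨i, b⟩⟩
    exact ((hne i).1 ⟨b⟩).map (pt i)
  · rintro ⟨⟨i, b⟩⟩
    exact ((hne i).2 ⟨b⟩).map (pt i)

end PriorityAutomaton

/-! ### The finite quotient and the theorem -/

section Quotient

variable {A : Type u} {S : Type} (φ : Diamond A → S)

/-- A map on `A^⋄` whose kernel is compatible with products induces a product on its range. -/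
noncomputable def rangeProduct (w : Diamond (Set.range φ)) : Set.range φ :=
  ⟨φ (Diamond.prod fun x => (w.out.letter x).2.choose), _, rfl⟩

theorem rangeProduct_of {α : Type} [LinearOrder α] [Countable α] [IsScattered α]
    (x : α → Set.range φ) :
    (rangeProduct φ (Diamond.of x) : S) = φ (Diamond.prod fun i => (x i).2.choose) := by
  obtain ⟨e, he⟩ := Diamond.exists_iso_of_out x
  exact congrArg φ (Diamond.prod_reindex e _ _ fun i => congrArg (fun s : Set.range φ => s.2.choose) (he i)).symm

/-- Products are computed on chosen preimages; by `hφ` the choice is irrelevant, so associativity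
descends from `A^⋄`. -/
theorem exists_diamondSemigroup_range
    (hφ : ∀ (α : Type) [LinearOrder α] [Countable α] [IsScattered α] (u v : α → Diamond A),
      (∀ i, φ (u i) = φ (v i)) → φ (Diamond.prod u) = φ (Diamond.prod v)) :
    ∃ _ : DiamondSemigroup (Set.range φ), IsDiamondMorphism (Set.rangeFactorization φ) := by
  refine ⟨⟨rangeProduct φ, fun s => ?_, fun α _ _ _ u => ?_⟩, fun α _ _ _ x => ?_⟩
  · refine Subtype.ext ((rangeProduct_of φ _).trans ?_)
    exact (congrArg φ (Diamond.flatten_single _)).trans s.2.choose_spec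
  · refine Subtype.ext ((rangeProduct_of φ _).trans ?_)
    let v : ∀ i, (u i).out.domain → Diamond A := fun i x => ((u i).out.letter x).2.choose
    have h1 : ∀ i, φ (rangeProduct φ (u i)).2.choose = φ (Diamond.prod (v i)) := fun i =>
      (rangeProduct φ (u i)).2.choose_spec
    rw [hφ α _ _ h1]
    refine (congrArg φ (Diamond.flatten_flatten fun i => Diamond.of (v i))).trans ?_
    rw [Diamond.prod_of]
    exact (rangeProduct_of φ _).symm
  · refine Subtype.ext (Eq.trans ?_ (rangeProduct_of φ _).symm)
    exact hφ α _ _ fun i => (Set.rangeFactorization φ (x i)).2.choose_spec.symm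

end Quotient

theorem IsPriorityAccepted.isDiamondRecognizable {A : Type u} {L : Set (Diamond A)}
    (hL : IsPriorityAccepted L) : IsDiamondRecognizable L := by
  obtain ⟨Q, _, M, rfl⟩ := hL
  let φ : Diamond A → Set (Q × Q × Set Q) × Prop :=
    Quotient.lift (fun w : ScatteredWord A => M.profile w.letter)
      fun w w' (h : ScatteredWord.Iso w w') => h.elim fun e he => M.profile_eq_of_iso e he
  have hφ : ∀ w : Diamond A, φ w = M.profile w.out.letter := fun w =>
    congrArg φ (Diamond.of_out w).symm
  obtain ⟨_, hmor⟩ := exists_diamondSemigroup_range φ fun α _ _ _ u v h =>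
    M.profile_sigma_congr fun i => (hφ (u i)).symm.trans ((h i).trans (hφ (v i)))
  refine ⟨Set.range φ, inferInstance, _, Set.rangeFactorization φ, hmor, ?_⟩
  have hacc : ∀ w, w ∈ M.language ↔ ∃ p ∈ M.init, ∃ q ∈ M.final, ∃ P, (p, q, P) ∈ (φ w).1 := by
    intro w
    induction w using Quotient.inductionOn with
    | h w =>
    constructor
    · rintro ⟨ρ, hρ, hi, hf⟩
      exact ⟨_, hi, _, hf, _, ρ, hρ, rfl⟩
    · rintro ⟨p, hp, q, hq, P, ρ, hρ, he⟩
      obtain ⟨rfl, he'⟩ := Prod.mk.inj he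
      obtain ⟨rfl, -⟩ := Prod.mk.inj he'
      exact ⟨ρ, hρ, hp, hq⟩
  refine Set.Subset.antisymm ?_ (Set.subset_preimage_image _ _)
  rintro w ⟨w', hw', he⟩
  have he' : φ w' = φ w := congrArg Subtype.val he
  rw [hacc] at hw' ⊢
  rwa [he'] at hw'

/-- A union of fibres of `φ` has a union of fibres as its complement. -/
theorem IsDiamondRecognizable.compl {A : Type u} {L : Set (Diamond A)}
    (hL : IsDiamondRecognizable L) : IsDiamondRecognizable Lᶜ := by
  obtain ⟨S, hS, hS', φ, hφ, h⟩ := hL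
  refine ⟨S, hS, hS', φ, hφ, Set.Subset.antisymm ?_ (Set.subset_preimage_image _ _)⟩
  rintro w ⟨w', hw', he⟩ hw
  refine hw' ?_
  rw [← h]
  exact ⟨w, hw, he.symm⟩

theorem theorem4p3 (A : Type*) [Finite A] :
    (∀ L : Set (Diamond A), IsPriorityAccepted L ↔ IsDiamondRecognizable L) ∧
      (∀ L : Set (Diamond A), IsPriorityAccepted L → IsPriorityAccepted Lᶜ) :=
  ⟨fun _ => ⟨IsPriorityAccepted.isDiamondRecognizable, IsDiamondRecognizable.isPriorityAccepted⟩,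
    fun _ hL => hL.isDiamondRecognizable.compl.isPriorityAccepted⟩
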